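/- Let $R$ be a commutative ring (for instance a field). Chain complexes are $\mathbb{Z}$-graded with differential of degree $-1$, and signs follow the Koszul rule: $(sC)_n=C_{n-1}$ with $d(sx)=-s(dx)$, $(s^{-1}C)_n=C_{n+1}$ with $d(s^{-1}x)=-s^{-1}(dx)$, $(C^\vee)_n=\mathrm{Hom}(C_{-n},R)$ with $df=-(-1)^{|f|}f\circ d$, and $(f_1\otimes\dots\otimes f_r)(x_1\otimes\dots\otimes x_r)=(-1)^{\sum_{j<i}|f_i||x_j|}f_1(x_1)\cdots f_r(x_r)$. **Spaces.** For a based simplicial set $X$, the reduced suspension $\Sigma X$ has as $n$-simplices the pairs $(x,j)$ with $0\le j\le n$, $x\in X_{n-j}$, where all $(*,j)$ and all $(x,0)$ are identified with the base point; $d_i(x,j)=(x,j-1)$, $s_i(x,j)=(x,j+1)$ for $i<j$, and $d_i(x,j)=(d_{i-j}x,j)$, $s_i(x,j)=(s_{i-j}x,j)$ for $i\ge j$, where $d_j(x,j)$ is the base point if $x$ is a vertex. $\tilde N_*(X)$ denotes the reduced normalized chains over $R$ (free on the non-degenerate simplices other than the base vertex; other simplices have class $0$), and $\tilde N^*(X)=\tilde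 N_*(X)^\vee$. **Operads.** All arities are $r\ge 1$. $\mathcal X_\infty(r)_d$ is free on the surjections $u=(u(1),\dots,u(r+d))$ onto $\{1,\dots,r\}$ with $u(i)\ne u(i+1)$ (all other sequences represent $0$). $\mathcal E_\infty(r)_d$ is free on the tuples $(w_0,\dots,w_d)$ in $S_r$ with $w_i\neq w_{i+1}$ (degenerate tuples represent $0$). $(\mathcal S^{-1}\mathcal P)(r)_d=\mathcal P(r)_{d-r+1}$. The suspension morphisms are $$\sigma(u)=\mathrm{sgn}(u(1),\dots,u(r))\,(u(r),\dots,u(r+d)),\qquad \sigma(w_0,\dots,w_d)=\mathrm{sgn}(w_0(1),\dots,w_{r-1}(1))\,(w_{r-1},\dots,w_d),$$ where $\mathrm{sgn}$ of a sequence that is not a permutation of $\{1,\dots,r\}$ is $0$. The table reduction $TR:\mathcal E_\infty\to\mathcal X_\infty$ sends $(w_0,\dots,w_d)$ to the sum, over all $a_0,\dots,a_d\ge1$ with $\sum a_i=r+d$, of the sequence obtained by concatenating rows $0,\dots,d$, where row $i$ consists of the first $a_i$ terms of $(w_i(1),\dots,w_i(r))$ that do not occur in an earlier row in a position other than the last one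 of that row. **Structures.** $u\in\mathcal X_\infty(r)_d$ acts on $\tilde N_*(X)$ by $u(x)=\sum\pm x(\Delta(C_{(1)}))\otimes\dots\otimes x(\Delta(C_{(r)}))$, for $x$ a non-degenerate $n$-simplex, the sum being over all cuts $0=n_0\le n_1\le\dots\le n_{r+d}=n$, where $C_{(k)}$ is the union of the intervals $[n_{i-1},n_i]$ with $u(i)=k$ and terms in which a vertex is repeated in some $C_{(k)}$ are $0$. Call the $i$-th interval final if $u(i)$ is the last occurrence of its value and inner otherwise; its length is $n_i-n_{i-1}$ if final and $n_i-n_{i-1}+1$ if inner. The sign is the Koszul sign of the shuffle sorting the intervals by the values $u(i)$, with the lengths as degrees, times $(-1)^{n_i}$ for every inner interval. It acts on $\tilde N^*(X)$ by $u(f_1,\dots,f_r)(x)=(-1)^{|u|(|f_1|+\dots+|f_r|)}(f_1\otimes\dots\otimes f_r)(u(x))$. $\mathcal E_\infty$ acts through $TR$. For a coalgebra $C$ and an algebra $A$ over $\mathcal P=\mathcal X_\infty$ or $\mathcal E_\infty$, $\sigma C$ is $sC$ and $\sigma^{-1}A$ is $s^{-1}A$ with the $\mathcal P$-structure pulled back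 along $\sigma$ from the $\mathcal S^{-1}\mathcal P$-structure: $$u(sx)=\sum(-1)^{|\sigma(u)|+\sum_i|x_i|(r-i)}\,sx_1\otimes\dots\otimes sx_r\quad\text{if }\sigma(u)(x)=\sum x_1\otimes\dots\otimes x_r,$$ $$u(s^{-1}x_1,\dots,s^{-1}x_r)=(-1)^{r|\sigma(u)|+\sum_i|x_i|(r-i)+r(r-1)/2}\,s^{-1}\sigma(u)(x_1,\dots,x_r),$$ where $|\sigma(u)|=|u|-r+1$ is the degree in $\mathcal P$. A (co)algebra isomorphism is an isomorphism of chain complexes commuting with the action of all $u\in\mathcal P(r)_d$, for all $r$ and $d$. **Theorem.** (a) For every based simplicial set $X$ there is an isomorphism of chain complexes $$\varphi_X:s\tilde N_*(X)\to\tilde N_*(\Sigma X),\qquad \varphi_X(sx)=(x,1),$$ which is natural in $X$ for based maps, and which is an isomorphism $\sigma\tilde N_*(X)\cong\tilde N_*(\Sigma X)$ both of $\mathcal X_\infty$-coalgebras and of $\mathcal E_\infty$-coalgebras. (b) For every based simplicial set $X$ there is an isomorphism of chain complexes $$\psi_X:s^{-1}\tilde N^*(X)\to\tilde N^*(\Sigma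 X),\qquad \psi_X(s^{-1}\alpha)(x,1)=(-1)^{|\alpha|}\alpha(x),$$ which is natural in $X$ for based maps, and which is an isomorphism $\sigma^{-1}\tilde N^*(X)\cong\tilde N^*(\Sigma X)$ both of $\mathcal X_\infty$-algebras and of $\mathcal E_\infty$-algebras. -/

import Mathlib

open CategoryTheory Simplicial Opposite
open scoped TensorProduct

universe u v w

namespace EInftySusp

/-! ## Based simplicial sets and the reduced suspension -/

/-- A simplicial set with a base vertex. -/
structure PSSet where
  sset : SSet.{u}
  pt : sset _⦋0⦌

namespace PSSet

/-- The `n`-dimensional base simplex: the iterated degeneracy of the base vertex. -/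
def base (X : PSSet.{u}) (n : ℕ) : X.sset _⦋n⦌ :=
  X.sset.map (SimplexCategory.const ⦋n⦌ ⦋0⦌ 0).op X.pt

/-- Base point preserving maps of simplicial sets. -/
structure Hom (X Y : PSSet.{u}) where
  map : X.sset ⟶ Y.sset
  map_pt : map.app (op ⦋0⦌) X.pt = Y.pt

theorem map_base (X : PSSet.{u}) {m n : ℕ} (f : ⦋m⦌ ⟶ ⦋n⦌) :
    X.sset.map f.op (X.base n) = X.base m := by
  unfold base
  rw [← CategoryTheory.comp_apply, ← Functor.map_comp]
  rfl

theorem Hom.app_base {X Y : PSSet.{u}} (f : Hom X Y) (n : ℕ) :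
    f.map.app (op ⦋n⦌) (X.base n) = Y.base n := by
  unfold base
  rw [NatTrans.naturality_apply, f.map_pt]

/-- The `n`-simplices of `ΣX` other than the base simplex: pairs `(x, j)` with `1 ≤ j`,
`x ∈ X_k` not the base simplex, `j + k = n`. -/
structure SuspCell (X : PSSet.{u}) (n : ℕ) where
  j : ℕ
  k : ℕ
  one_le : 1 ≤ j
  add_eq : j + k = n
  x : X.sset _⦋k⦌
  ne_base : x ≠ X.base k

open Classical in
/-- The `n`-simplex `(x, j)` of `ΣX`, for `x ∈ X_k` and `j + k = n`.  It is the base simplex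
(`none`) if `j = 0` or if `x` is the base simplex of `X`. -/
noncomputable def suspSimplex (X : PSSet.{u}) {n : ℕ} (j k : ℕ) (h : j + k = n)
    (x : X.sset _⦋k⦌) : Option (SuspCell X n) :=
  if h' : 1 ≤ j ∧ x ≠ X.base k then some ⟨j, k, h'.1, h, x, h'.2⟩ else none

/-- The number of `i ∈ [m]` with `α i < j`. -/
def headLen {m n : ℕ} (α : Fin (m + 1) →o Fin (n + 1)) (j : ℕ) : ℕ :=
  (Finset.univ.filter fun i : Fin (m + 1) => (α i : ℕ) < j).card

/-- For `α : [m] → [n]` sending `{c, …, m}` to `{j, …, n}`, the induced map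
`[l] = {c, …, m} → {j, …, n} = [k]`. -/
def tailMap {m n : ℕ} (α : Fin (m + 1) →o Fin (n + 1)) {j k c l : ℕ} (h : j + k = n)
    (h' : c + l = m) : Fin (l + 1) →o Fin (k + 1) where
  toFun i := ⟨(α ⟨c + i, by omega⟩ : ℕ) - j, by
    have := (α ⟨c + i, by omega⟩).isLt; omega⟩
  monotone' a b hab := by
    have h1 : α ⟨c + a, by omega⟩ ≤ α ⟨c + b, by omega⟩ :=
      α.monotone (Fin.mk_le_mk.mpr (Nat.add_le_add_left hab c))
    have h2 : (α ⟨c + a, by omega⟩ : ℕ) ≤ (α ⟨c + b, by omega⟩ : ℕ) := h1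
    simp only [Fin.mk_le_mk]
    omega

/-- The action of a monotone map `α : [m] → [n]` on the simplices of `ΣX`: a simplex `(x, j)`
is sent to `(α'^* x, j')`, where `j'` is the number of `i` with `α i < j` and
`α' : [m - j'] → [n - j]` is the restriction of `α` to the remaining elements (shifted).  The
result is the base simplex if `j' = 0`, and also if `j' = m + 1` (no elements remain: the cone
point, which is identified with the base point).  On cofaces and codegeneracies this gives
`d_i (x, j) = (x, j - 1)` for `i < j` and `(d_{i-j} x, j)` for `j ≤ i`, and
`s_i (x, j) = (x, j + 1)` for `i < j` and `(s_{i-j} x, j)` for `j ≤ i`. -/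
noncomputable def suspMap (X : PSSet.{u}) {m n : ℕ} (α : Fin (m + 1) →o Fin (n + 1)) :
    Option (SuspCell X n) → Option (SuspCell X m) := fun t =>
  match t with
  | none => none
  | some s =>
    if h : headLen α s.j ≤ m then
      X.suspSimplex (headLen α s.j) (m - headLen α s.j) (by omega)
        (X.sset.map (SimplexCategory.mkHom
          (tailMap α s.add_eq (c := headLen α s.j) (l := m - headLen α s.j) (by omega))).op s.x)
    else none

theorem lt_headLen {m n : ℕ} (α : Fin (m + 1) →o Fin (n + 1)) (j : ℕ) (i : Fin (m + 1)) :
    (i : ℕ) < headLen α j ↔ (α i : ℕ) < j := by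
  unfold headLen
  constructor
  · intro h
    by_contra hc
    have hsub : (Finset.univ.filter fun i : Fin (m + 1) => (α i : ℕ) < j) ⊆ Finset.Iio i := by
      intro a ha
      simp only [Finset.mem_filter, Finset.mem_univ, true_and] at ha
      rw [Finset.mem_Iio]
      by_contra hle
      have h1 : (α i : ℕ) ≤ α a := α.monotone (not_lt.mp hle)
      omega
    have := Finset.card_le_card hsub
    simp at this
    omega
  · intro h
    have hsub : Finset.Iic i ⊆ (Finset.univ.filter fun i : Fin (m + 1) => (α i : ℕ) < j) := by
      intro a ha
      rw [Finset.mem_Iic] at ha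
      have h1 : (α a : ℕ) ≤ α i := α.monotone ha
      simp only [Finset.mem_filter, Finset.mem_univ, true_and]
      omega
    have := Finset.card_le_card hsub
    simp at this
    omega

theorem headLen_le {m n : ℕ} (α : Fin (m + 1) →o Fin (n + 1)) (j : ℕ) : headLen α j ≤ m + 1 := by
  unfold headLen
  exact (Finset.card_le_univ _).trans (by simp)

theorem headLen_eq {m n : ℕ} (α : Fin (m + 1) →o Fin (n + 1)) (j c : ℕ) (hc : c ≤ m + 1)
    (h : ∀ i : Fin (m + 1), (i : ℕ) < c ↔ (α i : ℕ) < j) : headLen α j = c := by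
  have h1 := headLen_le α j
  by_contra hne
  rcases Nat.lt_or_gt_of_ne hne with hlt | hlt
  · have := (lt_headLen α j ⟨headLen α j, by omega⟩).not.mp (by simp)
    exact this ((h _).mp hlt)
  · have := (lt_headLen α j ⟨c, by omega⟩).mp hlt
    exact absurd ((h _).mpr this) (by simp)

theorem suspSimplex_congr (X : PSSet.{u}) {n k₀ : ℕ} {j j' k k' : ℕ} (h : j + k = n)
    (h' : j' + k' = n) (y : X.sset _⦋k₀⦌) (f : Fin (k + 1) →o Fin (k₀ + 1))
    (f' : Fin (k' + 1) →o Fin (k₀ + 1)) (hj : j = j')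
    (hf : ∀ (i : ℕ) (hi : i < k + 1) (hi' : i < k' + 1), f ⟨i, hi⟩ = f' ⟨i, hi'⟩) :
    X.suspSimplex j k h (X.sset.map (SimplexCategory.mkHom f).op y) =
      X.suspSimplex j' k' h' (X.sset.map (SimplexCategory.mkHom f').op y) := by
  subst hj
  obtain rfl : k = k' := by omega
  have : f = f' := by ext i; exact congrArg Fin.val (hf i i.2 i.2)
  rw [this]

theorem suspMap_id (X : PSSet.{u}) (n : ℕ) (s : Option (SuspCell X n)) :
    X.suspMap OrderHom.id s = s := by
  rcases s with _ | ⟨j, k, h1, h2, x, hx⟩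
  · rfl
  · have hz : headLen (OrderHom.id : Fin (n + 1) →o Fin (n + 1)) j = j :=
      headLen_eq _ _ _ (by omega) (fun i => Iff.rfl)
    have hle : headLen (OrderHom.id : Fin (n + 1) →o Fin (n + 1)) j ≤ n := by omega
    simp only [suspMap, hle, dif_pos]
    rw [X.suspSimplex_congr _ h2 x _ OrderHom.id hz]
    · have : SimplexCategory.mkHom (OrderHom.id : Fin (k + 1) →o Fin (k + 1)) = 𝟙 ⦋k⦌ := rfl
      rw [this]
      simp [suspSimplex, h1, hx]
    · intro i hi hi'
      ext
      simp [tailMap, hz]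

theorem suspMap_suspSimplex (X : PSSet.{u}) {m n j k : ℕ} (α : Fin (m + 1) →o Fin (n + 1))
    (h : j + k = n) (x : X.sset _⦋k⦌) :
    X.suspMap α (X.suspSimplex j k h x) =
      if h' : headLen α j ≤ m then
        X.suspSimplex (headLen α j) (m - headLen α j) (by omega)
          (X.sset.map (SimplexCategory.mkHom
            (tailMap α h (c := headLen α j) (l := m - headLen α j) (by omega))).op x)
      else none := by
  by_cases hx : 1 ≤ j ∧ x ≠ X.base k
  · simp [suspSimplex, hx, suspMap]
  · have h0 : X.suspSimplex j k h x = none := by simp only [suspSimplex, hx, dif_neg, not_false_eq_true]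
    rw [h0]
    simp only [suspMap]
    split_ifs with h'
    · symm
      unfold suspSimplex
      rw [dif_neg]
      rintro ⟨h1, h2⟩
      by_cases hj : 1 ≤ j
      · have hxb : x = X.base k := by
          by_contra hc
          exact hx ⟨hj, hc⟩
        subst hxb
        exact h2 (X.map_base _)
      · have := (lt_headLen α j 0).mp h1
        omega
    · rfl

theorem suspMap_comp (X : PSSet.{u}) {l m n : ℕ} (γ : Fin (l + 1) →o Fin (m + 1))
    (α : Fin (m + 1) →o Fin (n + 1)) (s : Option (SuspCell X n)) :
    X.suspMap (α.comp γ) s = X.suspMap γ (X.suspMap α s) := by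
  rcases s with _ | ⟨j, k, h1, h2, x, hx⟩
  · rfl
  · have hz : headLen (α.comp γ) j = headLen γ (headLen α j) :=
      headLen_eq _ _ _ (headLen_le _ _) (fun i => by
        rw [lt_headLen, lt_headLen]; rfl)
    by_cases hle : headLen α j ≤ m
    · have hs : X.suspMap α (some ⟨j, k, h1, h2, x, hx⟩) = _ := dif_pos hle
      rw [hs, suspMap_suspSimplex]
      by_cases hle' : headLen γ (headLen α j) ≤ l
      · rw [dif_pos hle']
        have hle'' : headLen (α.comp γ) j ≤ l := by omega
        have hs' : X.suspMap (α.comp γ) (some ⟨j, k, h1, h2, x, hx⟩) = _ := dif_pos hle''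
        rw [hs', ← CategoryTheory.comp_apply, ← Functor.map_comp, ← op_comp]
        have hc : ∀ (a b c : ℕ) (f : Fin (a + 1) →o Fin (b + 1)) (g : Fin (b + 1) →o Fin (c + 1)),
            SimplexCategory.mkHom f ≫ SimplexCategory.mkHom g =
              SimplexCategory.mkHom (g.comp f) := fun _ _ _ _ _ => rfl
        rw [hc]
        refine X.suspSimplex_congr _ _ x _ _ hz ?_
        intro i hi hi'
        change i < l - headLen γ (headLen α j) + 1 at hi'
        ext
        have key : headLen α j ≤ (γ ⟨headLen γ (headLen α j) + i, by omega⟩ : ℕ) := by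
          by_contra hcon
          have := (lt_headLen γ (headLen α j)
            ⟨headLen γ (headLen α j) + i, by omega⟩).mpr (by omega)
          simp at this
        have e : (⟨headLen α j + ((γ ⟨headLen γ (headLen α j) + i, by omega⟩ : ℕ) - headLen α j),
            by omega⟩ : Fin (m + 1)) = γ ⟨headLen γ (headLen α j) + i, by omega⟩ := by
          ext; simp only; omega
        have e₀ : (⟨headLen (α.comp γ) j + i, by omega⟩ : Fin (l + 1)) =
            ⟨headLen γ (headLen α j) + i, by omega⟩ := by
          ext; simp only [hz]
        change (α (γ ⟨headLen (α.comp γ) j + i, _⟩) : ℕ) - j = (α ⟨headLen α j +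
          ((γ ⟨headLen γ (headLen α j) + i, _⟩ : ℕ) - headLen α j), _⟩ : ℕ) - j
        rw [e, e₀]
      · rw [dif_neg hle']
        exact dif_neg (by simp only; omega)
    · have hs : X.suspMap α (some ⟨j, k, h1, h2, x, hx⟩) = none := dif_neg hle
      rw [hs]
      have h3 : headLen (α.comp γ) j = l + 1 :=
        headLen_eq _ _ _ le_rfl (fun i => ⟨fun _ => by
          have := (lt_headLen α j (γ i)).mp (by have := (γ i).isLt; omega)
          exact this, fun _ => i.isLt⟩)
      exact dif_neg (by simp only; omega)

/-- The reduced suspension `ΣX` of a based simplicial set: the quotient of the reduced cone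
`CX = {(x, j)}` by the subobject `X = {(x, 0)}`, based at the class of the base point. -/
noncomputable def susp (X : PSSet.{u}) : PSSet.{u} where
  sset :=
    { obj := fun Δ => Option (SuspCell X Δ.unop.len)
      map := fun f => ↾(X.suspMap f.unop.toOrderHom)
      map_id := fun _ => ConcreteCategory.hom_ext _ _ fun s => X.suspMap_id _ s
      map_comp := fun f g => ConcreteCategory.hom_ext _ _ fun s =>
        X.suspMap_comp g.unop.toOrderHom f.unop.toOrderHom s }
  pt := (none : Option (SuspCell X 0))

/-- `(x, j)` as a simplex of `ΣX`. -/
noncomputable def inSusp (X : PSSet.{u}) {k : ℕ} (j : ℕ) (x : X.sset _⦋k⦌) :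
    X.susp.sset _⦋j + k⦌ :=
  X.suspSimplex j k rfl x

/-- `Σf (x, j) = (f x, j)`. -/
noncomputable def Hom.suspFun {X Y : PSSet.{u}} (f : Hom X Y) {n : ℕ} :
    Option (SuspCell X n) → Option (SuspCell Y n) := fun t =>
  match t with
  | none => none
  | some s => Y.suspSimplex s.j s.k s.add_eq (f.map.app (op ⦋s.k⦌) s.x)

theorem Hom.suspFun_suspSimplex {X Y : PSSet.{u}} (f : Hom X Y) {n j k : ℕ} (h : j + k = n)
    (x : X.sset _⦋k⦌) :
    f.suspFun (X.suspSimplex j k h x) = Y.suspSimplex j k h (f.map.app (op ⦋k⦌) x) := by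
  by_cases hx : 1 ≤ j ∧ x ≠ X.base k
  · have h0 : X.suspSimplex j k h x = some ⟨j, k, hx.1, h, x, hx.2⟩ := dif_pos hx
    rw [h0]
    rfl
  · have h0 : X.suspSimplex j k h x = none := dif_neg hx
    rw [h0]
    symm
    refine dif_neg ?_
    rintro ⟨h1, h2⟩
    refine hx ⟨h1, ?_⟩
    rintro rfl
    exact h2 (f.app_base k)

theorem Hom.suspFun_suspMap {X Y : PSSet.{u}} (f : Hom X Y) {m n : ℕ}
    (α : Fin (m + 1) →o Fin (n + 1)) (s : Option (SuspCell X n)) :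
    f.suspFun (X.suspMap α s) = Y.suspMap α (f.suspFun s) := by
  rcases s with _ | ⟨j, k, h1, h2, x, hx⟩
  · rfl
  · have h0 : f.suspFun (some ⟨j, k, h1, h2, x, hx⟩) =
      Y.suspSimplex j k h2 (f.map.app (op ⦋k⦌) x) := rfl
    rw [h0, suspMap_suspSimplex]
    by_cases hle : headLen α j ≤ m
    · have hs : X.suspMap α (some ⟨j, k, h1, h2, x, hx⟩) = _ := dif_pos hle
      rw [hs, dif_pos hle, f.suspFun_suspSimplex, NatTrans.naturality_apply]
    · have hs : X.suspMap α (some ⟨j, k, h1, h2, x, hx⟩) = none := dif_neg hle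
      rw [hs, dif_neg hle]
      rfl

/-- The suspension of a based map. -/
noncomputable def Hom.susp {X Y : PSSet.{u}} (f : Hom X Y) : Hom X.susp Y.susp where
  map :=
    { app := fun _ => ↾f.suspFun
      naturality := fun _ _ g => ConcreteCategory.hom_ext _ _ fun s =>
        f.suspFun_suspMap g.unop.toOrderHom s }
  map_pt := rfl

end PSSet

/-! ## Reduced normalized chains

Chain complexes are `ℤ`-graded, with differential of degree `-1`. -/

section Chains

variable (R : Type v) [CommRing R]

/-- The non-degenerate simplices of `X` of dimension `n`, other than the base vertex. -/
structure Cell (X : PSSet.{u}) (n : ℤ) where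
  dim : ℕ
  x : X.sset _⦋dim⦌
  dim_eq : (dim : ℤ) = n
  nondeg : x ∈ X.sset.nonDegenerate dim
  ne_base : x ≠ X.base dim

open Classical in
/-- The class in `Ñ_n(X)` of a simplex `x` of `X`: the basis element `x` if `x` is
a non-degenerate `n`-simplex other than the base vertex, and `0` otherwise. -/
noncomputable def cls (X : PSSet.{u}) (n : ℤ) {k : ℕ} (x : X.sset _⦋k⦌) : Cell X n →₀ R :=
  if h : (k : ℤ) = n ∧ x ∈ X.sset.nonDegenerate k ∧ x ≠ X.base k then
    Finsupp.single ⟨k, x, h.1, h.2.1, h.2.2⟩ 1 else 0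

/-- `∑ᵢ (-1)ⁱ dᵢ x`, as an element of `Ñ_j(X)`. -/
noncomputable def bd (X : PSSet.{u}) (j : ℤ) (k : ℕ) : X.sset _⦋k⦌ → (Cell X j →₀ R) :=
  match k with
  | 0 => fun _ => 0
  | l + 1 => fun x => ∑ i : Fin (l + 2), (-1 : R) ^ (i : ℕ) • cls R X j (X.sset.δ i x)

variable {R} in
theorem cls_of_ne (X : PSSet.{u}) (n : ℤ) {k : ℕ} (x : X.sset _⦋k⦌) (h : (k : ℤ) ≠ n) :
    cls R X n x = 0 := dif_neg fun h' => h h'.1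

variable {R} in
theorem cls_degenerate (X : PSSet.{u}) (n : ℤ) {k : ℕ} (x : X.sset _⦋k⦌)
    (h : x ∈ X.sset.degenerate k) : cls R X n x = 0 := dif_neg fun h' => h'.2.1 h

variable {R} in
theorem cls_base (X : PSSet.{u}) (n : ℤ) (k : ℕ) : cls R X n (X.base k) = 0 :=
  dif_neg fun h' => h'.2.2 rfl

variable {R} in
theorem cls_cell (X : PSSet.{u}) (n : ℤ) (s : Cell X n) :
    cls R X n s.x = Finsupp.single s 1 := dif_pos ⟨s.dim_eq, s.nondeg, s.ne_base⟩

variable {R} in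
theorem bd_of_ne (X : PSSet.{u}) (j : ℤ) (k : ℕ) (x : X.sset _⦋k⦌) (h : j + 1 ≠ k) :
    bd R X j k x = 0 := by
  cases k with
  | zero => rfl
  | succ k =>
    refine Finset.sum_eq_zero fun i _ => ?_
    rw [cls_of_ne X j _ (by push_cast at h; omega), smul_zero]

variable {R} in
theorem bd_base (X : PSSet.{u}) (j : ℤ) (k : ℕ) : bd R X j k (X.base k) = 0 := by
  cases k with
  | zero => rfl
  | succ k =>
    refine Finset.sum_eq_zero fun i _ => ?_
    have : X.sset.δ i (X.base (k + 1)) = X.base k := X.map_base _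
    rw [this, cls_base, smul_zero]

variable {R} in
theorem bd_degenerate (X : PSSet.{u}) (j : ℤ) (k : ℕ) (x : X.sset _⦋k⦌)
    (h : x ∈ X.sset.degenerate k) : bd R X j k x = 0 := by
  cases k with
  | zero => rfl
  | succ k =>
    rw [SSet.degenerate_eq_iUnion_range_σ, Set.mem_iUnion] at h
    obtain ⟨a, y, rfl⟩ := h
    have hl : ∀ i : Fin (k + 2), i < a.castSucc → cls R X j (X.sset.δ i (X.sset.σ a y)) = 0 := by
      intro i hi
      cases k with
      | zero => exact absurd hi (by have := a.isLt; rw [Fin.lt_def, Fin.val_castSucc]; omega)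
      | succ k =>
        refine cls_degenerate X j _ ?_
        obtain ⟨a, rfl⟩ := Fin.eq_succ_of_ne_zero (i := a) (by
          rintro rfl; exact absurd hi (by simp))
        obtain ⟨i, rfl⟩ := Fin.eq_castSucc_of_ne_last (x := i) (by
          rintro rfl
          have := a.isLt
          simp only [Fin.lt_def, Fin.val_last, Fin.val_castSucc, Fin.val_succ] at hi; omega)
        have := CategoryTheory.SimplicialObject.δ_comp_σ_of_le (X := X.sset) (i := i) (j := a)
          (by simp only [Fin.lt_def, Fin.le_def, Fin.val_castSucc, Fin.val_succ] at hi ⊢; omega)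
        have e := ConcreteCategory.congr_hom this y
        simp only [CategoryTheory.comp_apply] at e
        rw [e]
        exact SSet.σ_mem_degenerate _ _ _
    have hr : ∀ i : Fin (k + 2), a.succ < i → cls R X j (X.sset.δ i (X.sset.σ a y)) = 0 := by
      intro i hi
      cases k with
      | zero =>
        exact absurd hi (by
          have := i.isLt; simp only [Fin.lt_def, Fin.val_succ, not_lt]; omega)
      | succ k =>
        refine cls_degenerate X j _ ?_
        obtain ⟨i, rfl⟩ := Fin.eq_succ_of_ne_zero (i := i) (by
          rintro rfl; exact absurd hi (by simp))
        obtain ⟨a, rfl⟩ := Fin.eq_castSucc_of_ne_last (x := a) (by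
          rintro rfl
          have := i.isLt
          simp only [Fin.lt_def, Fin.val_last, Fin.val_succ] at hi; omega)
        have := CategoryTheory.SimplicialObject.δ_comp_σ_of_gt (X := X.sset) (i := i) (j := a)
          (by simp only [Fin.lt_def, Fin.val_castSucc, Fin.val_succ] at hi ⊢; omega)
        have e := ConcreteCategory.congr_hom this y
        simp only [CategoryTheory.comp_apply] at e
        rw [e]
        exact SSet.σ_mem_degenerate _ _ _
    have e1 : X.sset.δ a.castSucc (X.sset.σ a y) = y := by
      have := ConcreteCategory.congr_hom
        (CategoryTheory.SimplicialObject.δ_comp_σ_self (X := X.sset) (i := a)) y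
      simpa only [CategoryTheory.comp_apply, CategoryTheory.id_apply] using this
    have e2 : X.sset.δ a.succ (X.sset.σ a y) = y := by
      have := ConcreteCategory.congr_hom
        (CategoryTheory.SimplicialObject.δ_comp_σ_succ (X := X.sset) (i := a)) y
      simpa only [CategoryTheory.comp_apply, CategoryTheory.id_apply] using this
    change ∑ i : Fin (k + 2), (-1 : R) ^ (i : ℕ) • cls R X j (X.sset.δ i (X.sset.σ a y)) = 0
    rw [Finset.sum_eq_add_of_mem a.castSucc a.succ (Finset.mem_univ _) (Finset.mem_univ _)
      (by simp [Fin.ext_iff])]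
    · rw [e1, e2, Fin.val_succ, Fin.val_castSucc, pow_succ]
      simp
    · intro c _ hc
      rcases lt_or_gt_of_ne hc.1 with h | h
      · rw [hl c h, smul_zero]
      · rw [hr c, smul_zero]
        have h2 := hc.2
        rw [Ne, Fin.ext_iff] at h2
        simp only [Fin.lt_def, Fin.val_castSucc, Fin.val_succ] at h h2 ⊢
        omega

/-- The differential of `Ñ_*(X)`. -/
noncomputable def chainsD (X : PSSet.{u}) (i j : ℤ) : (Cell X i →₀ R) →ₗ[R] (Cell X j →₀ R) :=
  Finsupp.linearCombination R fun s => bd R X j s.dim s.x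

variable {R} in
theorem chainsD_cls (X : PSSet.{u}) (i j : ℤ) (hij : j + 1 = i) {k : ℕ} (x : X.sset _⦋k⦌) :
    chainsD R X i j (cls R X i x) = bd R X j k x := by
  by_cases h : (k : ℤ) = i ∧ x ∈ X.sset.nonDegenerate k ∧ x ≠ X.base k
  · have : cls R X i x = Finsupp.single ⟨k, x, h.1, h.2.1, h.2.2⟩ 1 := dif_pos h
    rw [this, chainsD, Finsupp.linearCombination_single, one_smul]
  · have : cls R X i x = 0 := dif_neg h
    rw [this, map_zero]
    symm
    by_cases h1 : (k : ℤ) = i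
    · by_cases h2 : x ∈ X.sset.nonDegenerate k
      · have h3 : x = X.base k := by
          by_contra h3
          exact h ⟨h1, h2, h3⟩
        rw [h3, bd_base]
      · exact bd_degenerate X j k x (not_not.mp h2)
    · exact bd_of_ne X j k x (by omega)

theorem sum_bd (X : PSSet.{u}) (j : ℤ) (k : ℕ) (x : X.sset _⦋k + 1⦌) :
    ∑ i : Fin (k + 2), (-1 : R) ^ (i : ℕ) • bd R X j k (X.sset.δ i x) = 0 := by
  cases k with
  | zero => exact Finset.sum_eq_zero fun i _ => by simp [bd]
  | succ k =>
    simp only [bd, Finset.smul_sum, smul_smul]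
    rw [Finset.sum_comm, ← Finset.sum_product']
    let P := Fin (k + 2) × Fin (k + 3)
    let S : Finset P := Finset.univ.filter fun ij : P => (ij.2 : ℕ) ≤ (ij.1 : ℕ)
    rw [Finset.univ_product_univ, ← Finset.sum_add_sum_compl S, ← eq_neg_iff_add_eq_zero,
      ← Finset.sum_neg_distrib]
    let φ : ∀ ij : P, ij ∈ S → P := fun ij hij =>
      (Fin.castLT ij.2 (lt_of_le_of_lt (Finset.mem_filter.mp hij).right (Fin.is_lt ij.1)),
        ij.1.succ)
    apply Finset.sum_bij φ
    · intro ij hij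
      simp_rw [S, φ, Finset.compl_filter, Finset.mem_filter_univ, Fin.val_succ,
        Fin.val_castLT] at hij ⊢
      lia
    · rintro ⟨i, j⟩ hij ⟨i', j'⟩ hij' h
      rw [Prod.mk_inj]
      exact ⟨by simpa [φ] using! congr_arg Prod.snd h,
        by simpa [φ, Fin.castSucc_castLT] using! congr_arg Fin.castSucc (congr_arg Prod.fst h)⟩
    · rintro ⟨i', j'⟩ hij'
      simp_rw [S, Finset.compl_filter, Finset.mem_filter_univ, not_le] at hij'
      refine ⟨(j'.pred <| ?_, Fin.castSucc i'), ?_, ?_⟩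
      · rintro rfl
        simp only [Fin.val_zero, not_lt_zero] at hij'
      · simpa [S] using! Nat.le_sub_one_of_lt hij'
      · simp only [φ, Fin.castLT_castSucc, Fin.succ_pred]
    · rintro ⟨i, j⟩ hij
      have h1 := ConcreteCategory.congr_hom
        (CategoryTheory.SimplicialObject.δ_comp_δ'' (X := X.sset) (i := j) (j := i)
          (by simpa [S] using! hij)) x
      simp only [CategoryTheory.comp_apply] at h1
      simp only [φ, h1, Fin.val_succ, Fin.val_castLT, ← neg_smul]
      congr 1
      ring

/-- The reduced normalized chains `Ñ_*(X) = N_*(X) / N_*(*)` of a based simplicial set. -/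
noncomputable def chains (X : PSSet.{u}) : ChainComplex (ModuleCat.{max u v} R) ℤ where
  X n := ModuleCat.of R (Cell X n →₀ R)
  d i j := ModuleCat.ofHom (chainsD R X i j)
  shape i j hij := by
    refine ModuleCat.hom_ext (Finsupp.lhom_ext' fun s => LinearMap.ext_ring ?_)
    change chainsD R X i j (Finsupp.single s 1) = 0
    rw [chainsD, Finsupp.linearCombination_single, bd_of_ne, smul_zero]
    intro h
    exact hij (by rw [ComplexShape.down_Rel]; rw [h, s.dim_eq])
  d_comp_d' i j k hij hjk := by
    refine ModuleCat.hom_ext (Finsupp.lhom_ext' fun s => LinearMap.ext_ring ?_)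
    change chainsD R X j k (Finsupp.linearCombination R _ (Finsupp.single s 1)) = 0
    rw [Finsupp.linearCombination_single, one_smul]
    obtain ⟨l, x, h1, h2, h3⟩ := s
    cases l with
    | zero => exact map_zero _
    | succ l =>
      change chainsD R X j k (∑ a : Fin (l + 2), (-1 : R) ^ (a : ℕ) • cls R X j (X.sset.δ a x)) = 0
      rw [map_sum]
      simp only [map_smul, chainsD_cls X j k hjk]
      exact sum_bd R X k l x

variable {R} in
theorem cls_app {X Y : PSSet.{u}} (f : X.Hom Y) (n : ℤ) {k : ℕ} (x : X.sset _⦋k⦌) :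
    Finsupp.linearCombination R
      (fun s : Cell X n => cls R Y n (f.map.app (op ⦋s.dim⦌) s.x)) (cls R X n x) =
        cls R Y n (f.map.app (op ⦋k⦌) x) := by
  by_cases h : (k : ℤ) = n ∧ x ∈ X.sset.nonDegenerate k ∧ x ≠ X.base k
  · have : cls R X n x = Finsupp.single ⟨k, x, h.1, h.2.1, h.2.2⟩ 1 := dif_pos h
    rw [this, Finsupp.linearCombination_single, one_smul]
  · have : cls R X n x = 0 := dif_neg h
    rw [this, map_zero]
    symm
    by_cases h1 : (k : ℤ) = n
    · by_cases h2 : x ∈ X.sset.nonDegenerate k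
      · have h3 : x = X.base k := by
          by_contra h3
          exact h ⟨h1, h2, h3⟩
        rw [h3, f.app_base, cls_base]
      · exact cls_degenerate Y n _ (SSet.degenerate_app_apply (not_not.mp h2) _)
    · exact cls_of_ne Y n _ h1

/-- The chain map `Ñ_*(X) → Ñ_*(Y)` induced by a based map `f`, `x ↦ f x`. -/
noncomputable def chainsMap {X Y : PSSet.{u}} (f : X.Hom Y) : chains R X ⟶ chains R Y where
  f n := ModuleCat.ofHom
    (Finsupp.linearCombination R fun s : Cell X n => cls R Y n (f.map.app (op ⦋s.dim⦌) s.x))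
  comm' i j hij := by
    rw [ComplexShape.down_Rel] at hij
    refine ModuleCat.hom_ext (Finsupp.lhom_ext' fun s => LinearMap.ext_ring ?_)
    change chainsD R Y i j (Finsupp.linearCombination R _ (Finsupp.single s 1)) =
      Finsupp.linearCombination R _ (chainsD R X i j (Finsupp.single s 1))
    rw [Finsupp.linearCombination_single, one_smul, chainsD_cls Y i j hij, chainsD,
      Finsupp.linearCombination_single, one_smul]
    obtain ⟨l, x, h1, h2, h3⟩ := s
    cases l with
    | zero => exact (LinearMap.map_zero (Finsupp.linearCombination R _)).symm
    | succ l =>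
      change ∑ a : Fin (l + 2), (-1 : R) ^ (a : ℕ) • cls R Y j (Y.sset.δ a (f.map.app (op ⦋l + 1⦌) x)) =
        Finsupp.linearCombination R _ (∑ a : Fin (l + 2), (-1 : R) ^ (a : ℕ) • cls R X j (X.sset.δ a x))
      rw [map_sum]
      refine Finset.sum_congr rfl fun a _ => ?_
      rw [map_smul, cls_app]
      congr 2
      exact (NatTrans.naturality_apply f.map (SimplexCategory.δ a).op x).symm

end Chains

/-! ## Suspension, desuspension and dual of chain complexes -/

/-- The sign `(-1)^e` in `R`. -/
def ksign (R : Type v) [CommRing R] (e : ℤ) : R := ((e.negOnePow : ℤ) : R)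

section Complexes

variable {R : Type v} [CommRing R]

/-- The suspension `sC = Ks ⊗ C`: `(sC)_n = C_{n-1}`, `d (s x) = - s (d x)`. -/
noncomputable abbrev suspC (C : ChainComplex (ModuleCat.{w} R) ℤ) :
    ChainComplex (ModuleCat.{w} R) ℤ where
  X n := C.X (n - 1)
  d i j := -C.d (i - 1) (j - 1)
  shape i j h := by
    rw [C.shape, neg_zero]
    rw [ComplexShape.down_Rel] at h ⊢
    omega
  d_comp_d' i j k _ _ := by simp

/-- The chain map `s f`. -/
noncomputable abbrev suspCMap {C D : ChainComplex (ModuleCat.{w} R) ℤ} (f : C ⟶ D) :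
    suspC C ⟶ suspC D where
  f n := f.f (n - 1)
  comm' i j _ := by simp

/-- The desuspension `s⁻¹C = Ks⁻¹ ⊗ C`: `(s⁻¹C)_n = C_{n+1}`, `d (s⁻¹ x) = - s⁻¹ (d x)`. -/
noncomputable abbrev desuspC (C : ChainComplex (ModuleCat.{w} R) ℤ) :
    ChainComplex (ModuleCat.{w} R) ℤ where
  X n := C.X (n + 1)
  d i j := -C.d (i + 1) (j + 1)
  shape i j h := by
    rw [C.shape, neg_zero]
    rw [ComplexShape.down_Rel] at h ⊢
    omega
  d_comp_d' i j k _ _ := by simp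

/-- The chain map `s⁻¹ f`. -/
noncomputable abbrev desuspCMap {C D : ChainComplex (ModuleCat.{w} R) ℤ} (f : C ⟶ D) :
    desuspC C ⟶ desuspC D where
  f n := f.f (n + 1)
  comm' i j _ := by simp

/-- The linear dual of a chain complex: `(C^∨)_n = Hom(C_{-n}, R)`, with the differential
`d f = -(-1)^{|f|} f ∘ d` of the Koszul sign rule. -/
noncomputable abbrev dualC (C : ChainComplex (ModuleCat.{max u v} R) ℤ) :
    ChainComplex (ModuleCat.{max u v} R) ℤ where
  X n := ModuleCat.of R (Module.Dual R (C.X (-n)))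
  d i j := ModuleCat.ofHom (-(ksign R i • (C.d (-j) (-i)).hom.dualMap))
  shape i j h := by
    rw [C.shape (-j) (-i) (by rw [ComplexShape.down_Rel] at h ⊢; omega)]
    ext f x
    simp
  d_comp_d' i j k _ _ := by
    ext f x
    have h : C.d (-j) (-i) (C.d (-k) (-j) x) = 0 := by
      rw [← CategoryTheory.comp_apply, C.d_comp_d]
      rfl
    simp [h]

/-- The transpose of a chain map. -/
noncomputable abbrev dualCMap {C D : ChainComplex (ModuleCat.{max u v} R) ℤ} (f : C ⟶ D) :
    dualC.{u, v} D ⟶ dualC.{u, v} C where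
  f n := ModuleCat.ofHom (f.f (-n)).hom.dualMap
  comm' i j _ := by
    ext g x
    have h : D.d (-j) (-i) (f.f (-j) x) = f.f (-i) (C.d (-j) (-i) x) := by
      rw [← CategoryTheory.comp_apply, ← CategoryTheory.comp_apply, f.comm]
    simp [h]

end Complexes

/-- The reduced normalized cochains `Ñ^*(X)`, in non-positive degrees. -/
noncomputable abbrev cochains (R : Type v) [CommRing R] (X : PSSet.{u}) :
    ChainComplex (ModuleCat.{max u v} R) ℤ :=
  dualC.{u, v} (chains R X)

/-! ## Coalgebras and algebras over an operad

Only the graded modules `P(r)_d` of an operad `P` enter here: a morphism of `P`-(co)algebras is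
by definition a chain map that commutes with the action of every element of every `P(r)_d`. -/

section Operations

variable {R : Type v} [CommRing R]

/-- The structure maps `P(r) ⊗ C → C^{⊗ r}` of a `P`-coalgebra.  The cooperation
`C → C^{⊗ r}` of `a ∈ P(r)_d` is given by its components `C_n → C_{p_1} ⊗ … ⊗ C_{p_r}`. -/
abbrev Coops (P : ℕ → ℤ → Type*) [∀ r d, AddCommGroup (P r d)] [∀ r d, Module R (P r d)]
    (C : ChainComplex (ModuleCat.{w} R) ℤ) :=
  ∀ (r : ℕ) (d : ℤ), P r d →ₗ[R]
    ∀ (n : ℤ) (p : Fin r → ℤ), C.X n →ₗ[R] ⨂[R] i, C.X (p i)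

/-- The structure maps `P(r) ⊗ A^{⊗ r} → A` of a `P`-algebra.  The operation
`A^{⊗ r} → A` of `a ∈ P(r)_d` is given by its components `A_{p_1} × … × A_{p_r} → A_n`. -/
abbrev Ops (P : ℕ → ℤ → Type*) [∀ r d, AddCommGroup (P r d)] [∀ r d, Module R (P r d)]
    (A : ChainComplex (ModuleCat.{w} R) ℤ) :=
  ∀ (r : ℕ) (d : ℤ), P r d →ₗ[R]
    ∀ (p : Fin r → ℤ) (n : ℤ), MultilinearMap R (fun i => A.X (p i)) (A.X n)

/-- The operadic desuspension: `(S⁻¹P)(r)_d = P(r)_{d-r+1}`. -/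
abbrev Desusp (P : ℕ → ℤ → Type*) : ℕ → ℤ → Type _ := fun r d => P r (d - r + 1)

variable {P Q : ℕ → ℤ → Type*}
  [∀ r d, AddCommGroup (P r d)] [∀ r d, Module R (P r d)]
  [∀ r d, AddCommGroup (Q r d)] [∀ r d, Module R (Q r d)]

/-- Pull-back of a `Q`-coalgebra structure along `P → Q`. -/
def Coops.pullback {C : ChainComplex (ModuleCat.{w} R) ℤ} (ρ : Coops Q C)
    (σ : ∀ r d, P r d →ₗ[R] Q r d) : Coops P C :=
  fun r d => ρ r d ∘ₗ σ r d

/-- Pull-back of a `Q`-algebra structure along `P → Q`. -/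
def Ops.pullback {A : ChainComplex (ModuleCat.{w} R) ℤ} (μ : Ops Q A)
    (σ : ∀ r d, P r d →ₗ[R] Q r d) : Ops P A :=
  fun r d => μ r d ∘ₗ σ r d

/-- The `S⁻¹P`-coalgebra structure on `sC` for a `P`-coalgebra `C`: if
`a(x) = ∑ x_1 ⊗ … ⊗ x_r`, then `a(s x) = ∑ ± s x_1 ⊗ … ⊗ s x_r` with the sign
`(-1)^(|a| + |x_1| (r - 1) + |x_2| (r - 2) + … + |x_{r-1}|)`, where `|a|` is the degree
in `P`. -/
noncomputable def Coops.susp {C : ChainComplex (ModuleCat.{w} R) ℤ} (ρ : Coops P C) :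
    Coops (Desusp P) (suspC C) := fun r d =>
  { toFun := fun a n p =>
      ksign R ((d - r + 1) + ∑ i : Fin r, (p i - 1) * ((r : ℤ) - 1 - (i : ℕ))) •
        ρ r (d - r + 1) a (n - 1) fun i => p i - 1
    map_add' := fun a b => by
      funext n p
      simp only [map_add, Pi.add_apply, smul_add]
    map_smul' := fun c a => by
      funext n p
      simp only [map_smul, Pi.smul_apply, RingHom.id_apply]
      rw [smul_comm] }

/-- The `S⁻¹P`-algebra structure on `s⁻¹A` for a `P`-algebra `A`:
`a(s⁻¹ x_1, …, s⁻¹ x_r) = ± s⁻¹ a(x_1, …, x_r)` with the sign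
`(-1)^(r |a| + |x_1| (r - 1) + |x_2| (r - 2) + … + |x_{r-1}| + r (r - 1) / 2)`, where `|a|` is
the degree in `P`.  This is the structure for which `s(s⁻¹A) = A` as algebras over
`S(S⁻¹P) = P`, where `S` is the endomorphism operad of `Ks` and `S⁻¹` its inverse for the
aritywise tensor product. -/
noncomputable def Ops.desusp {A : ChainComplex (ModuleCat.{w} R) ℤ} (μ : Ops P A) :
    Ops (Desusp P) (desuspC A) := fun r d =>
  { toFun := fun a p n =>
      ksign R (r * (d - r + 1) + ∑ i : Fin r, (p i + 1) * ((r : ℤ) - 1 - (i : ℕ)) +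
          (r * (r - 1) / 2 : ℕ)) •
        μ r (d - r + 1) a (fun i => p i + 1) (n + 1)
    map_add' := fun a b => by
      funext p n
      simp only [map_add, Pi.add_apply, smul_add]
    map_smul' := fun c a => by
      funext p n
      simp only [map_smul, Pi.smul_apply, RingHom.id_apply]
      rw [smul_comm] }

/-- The `P`-algebra structure on the dual of a `P`-coalgebra `C`:
`a(f_1, …, f_r)(x) = (-1)^(|a| (|f_1| + … + |f_r|)) (f_1 ⊗ … ⊗ f_r)(a(x))`, where
`(f_1 ⊗ … ⊗ f_r)(x_1 ⊗ … ⊗ x_r) = (-1)^(∑_{j < i} |f_i| |x_j|) f_1(x_1) ⋯ f_r(x_r)`. -/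
noncomputable def Coops.dual {C : ChainComplex (ModuleCat.{max u v} R) ℤ} (ρ : Coops P C) :
    Ops P (dualC.{u, v} C) := fun r d =>
  { toFun := fun a p n =>
      ksign R (d * ∑ i, p i + ∑ i, ∑ j ∈ Finset.univ.filter (· < i), p i * p j) •
        ((ρ r d a (-n) fun i => -p i).dualMap ∘ₗ PiTensorProduct.dualDistrib).compMultilinearMap
          (PiTensorProduct.tprod R)
    map_add' := fun a b => by
      funext p n
      ext f x
      simp [mul_add]
    map_smul' := fun c a => by
      funext p n
      ext f x
      simp [mul_left_comm] }

/-- A chain map is a morphism of `P`-coalgebras if it commutes with all cooperations. -/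
def IsCoalgHom {C D : ChainComplex (ModuleCat.{w} R) ℤ} (ρ : Coops P C) (ρ' : Coops P D)
    (f : C ⟶ D) : Prop :=
  ∀ (r : ℕ) (d : ℤ) (a : P r d) (n : ℤ) (p : Fin r → ℤ) (x : C.X n),
    PiTensorProduct.map (fun i => (f.f (p i)).hom) (ρ r d a n p x) = ρ' r d a n p (f.f n x)

/-- A chain map is a morphism of `P`-algebras if it commutes with all operations. -/
def IsAlgHom {A B : ChainComplex (ModuleCat.{w} R) ℤ} (μ : Ops P A) (μ' : Ops P B)
    (f : A ⟶ B) : Prop :=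
  ∀ (r : ℕ) (d : ℤ) (a : P r d) (p : Fin r → ℤ) (n : ℤ) (x : ∀ i, A.X (p i)),
    f.f n (μ r d a p n x) = μ' r d a p n fun i => f.f (p i) (x i)

end Operations

/-! ## The surjection operad and the Barratt–Eccles operad -/

section Operads

variable (R : Type v) [CommRing R]

/-- The non-degenerate surjections `u : {1, …, r + d} → {1, …, r}`, written as sequences
`(u(1), …, u(r + d))`; `{1, …, r}` is modelled by `Fin r`.  The operads are connected, with
nothing in arity `0`. -/
structure SurjSeq (r : ℕ) (d : ℤ) where
  seq : List (Fin r)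
  pos : 0 < r
  surj : ∀ k, k ∈ seq
  nondeg : seq.IsChain (· ≠ ·)
  length_eq : (seq.length : ℤ) = r + d

/-- `X_∞(r)_d`: the free module on the non-degenerate surjections. -/
abbrev SurjOp (r : ℕ) (d : ℤ) := SurjSeq r d →₀ R

open Classical in
/-- The element of `X_∞(r)_d` represented by a sequence; it is `0` if the sequence is not
surjective or is degenerate. -/
noncomputable def surjCls {r : ℕ} (d : ℤ) (l : List (Fin r)) : SurjOp R r d :=
  if h : 0 < r ∧ (∀ k, k ∈ l) ∧ l.IsChain (· ≠ ·) ∧ (l.length : ℤ) = r + d then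
    Finsupp.single ⟨l, h.1, h.2.1, h.2.2.1, h.2.2.2⟩ 1 else 0

/-- The sign of a sequence that is a permutation of `{1, …, r}`, and `0` for other sequences. -/
def sgn {r : ℕ} (l : List (Fin r)) : ℤ :=
  ∑ π : Equiv.Perm (Fin r), if List.ofFn π = l then (Equiv.Perm.sign π : ℤ) else 0

/-- The suspension morphism `σ : X_∞ → S⁻¹ X_∞`,
`σ(u) = sgn(u(1), …, u(r)) (u(r), …, u(r + d))`. -/
noncomputable def sigmaSurj (r : ℕ) (d : ℤ) : SurjOp R r d →ₗ[R] Desusp (SurjOp R) r d :=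
  Finsupp.linearCombination R fun u : SurjSeq r d =>
    (sgn (u.seq.take r) : R) • surjCls R (d - r + 1) (u.seq.drop (r - 1))

/-- The non-degenerate tuples `(w_0, …, w_d)` of permutations `w_i ∈ S_r`. -/
structure PermSeq (r : ℕ) (d : ℤ) where
  seq : List (Equiv.Perm (Fin r))
  pos : 0 < r
  ne_nil : seq ≠ []
  nondeg : seq.IsChain (· ≠ ·)
  length_eq : (seq.length : ℤ) = d + 1

/-- `E_∞(r)_d`: the free module on the non-degenerate tuples `(w_0, …, w_d)`. -/
abbrev BarrattEccles (r : ℕ) (d : ℤ) := PermSeq r d →₀ R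

open Classical in
/-- The element of `E_∞(r)_d` represented by a tuple; it is `0` if the tuple is degenerate. -/
noncomputable def permCls {r : ℕ} (d : ℤ) (l : List (Equiv.Perm (Fin r))) :
    BarrattEccles R r d :=
  if h : 0 < r ∧ l ≠ [] ∧ l.IsChain (· ≠ ·) ∧ (l.length : ℤ) = d + 1 then
    Finsupp.single ⟨l, h.1, h.2.1, h.2.2.1, h.2.2.2⟩ 1 else 0

/-- The suspension morphism `σ : E_∞ → S⁻¹ E_∞`,
`σ(w_0, …, w_d) = sgn(w_0(1), …, w_{r-1}(1)) (w_{r-1}, …, w_d)`. -/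
noncomputable def sigmaBE (r : ℕ) (d : ℤ) :
    BarrattEccles R r d →ₗ[R] Desusp (BarrattEccles R) r d :=
  Finsupp.linearCombination R fun w : PermSeq r d =>
    (sgn ((w.seq.take r).map fun π => π ⟨0, w.pos⟩) : R) •
      permCls R (d - r + 1) (w.seq.drop (r - 1))

/-- The concatenated rows of the table of `(w_0, …, w_d)` with row lengths `(a_0, …, a_d)`: the
`i`-th row consists of the first `a_i` terms of `(w_i(1), …, w_i(r))` that do not belong to
`used`, the set of the entries of the previous rows that are not the last entry of their row. -/
def tableRows {r : ℕ} (w : List (Equiv.Perm (Fin r))) (a : List ℕ) (used : List (Fin r)) :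
    List (Fin r) :=
  match w, a with
  | π :: w, m :: a =>
    let row := ((List.ofFn π).filter fun k => k ∉ used).take m
    row ++ tableRows w a (used ++ row.dropLast)
  | _, _ => []

/-- The table reduction morphism `TR : E_∞ → X_∞`: the image of `(w_0, …, w_d)` is the sum of
the table sequences over all row lengths `a_0, …, a_d ≥ 1` with `a_0 + … + a_d = r + d`. -/
noncomputable def tableReduction (r : ℕ) (d : ℤ) : BarrattEccles R r d →ₗ[R] SurjOp R r d :=
  Finsupp.linearCombination R fun w : PermSeq r d =>
    ∑ a : Composition (r + w.seq.length - 1),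
      if a.length = w.seq.length then surjCls R d (tableRows w.seq a.blocks []) else 0

end Operads

/-! ## The interval cut cooperations -/

section IntervalCut

variable (R : Type v) [CommRing R]

/-- The ways `0 = n_0 ≤ n_1 ≤ … ≤ n_m = k` to cut the interval `[0, k]` into `m` pieces. -/
noncomputable def cuts (m k : ℕ) : Finset (Fin (m + 1) → Fin (k + 1)) := by
  classical exact Finset.univ.filter fun c => Monotone c ∧ c 0 = 0 ∧ c (Fin.last m) = Fin.last k

variable {r : ℕ} (u : List (Fin r)) {k : ℕ} (c : Fin (u.length + 1) → Fin (k + 1))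

/-- The `i`-th interval is inner: `u(i)` is not the last occurrence of its value. -/
def IsInner (i : Fin u.length) : Prop := ∃ j, i < j ∧ u.get j = u.get i

open Classical in
/-- The length of the `i`-th interval `[n_{i-1}, n_i]`: it is `n_i - n_{i-1} + 1` for an inner
interval and `n_i - n_{i-1}` for a final one. -/
noncomputable def intervalLength (i : Fin u.length) : ℕ :=
  (c i.succ : ℕ) - (c i.castSucc : ℕ) + if IsInner u i then 1 else 0

open Classical in
/-- The exponent of the sign of a cut: the permutation sign, which is the Koszul sign of the
shuffle that sorts the intervals by the values of `u`, plus the position sign, which is the sum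
of the end points of the inner intervals. -/
noncomputable def cutSign : ℕ :=
  (∑ i, ∑ j, if i < j ∧ u.get j < u.get i then intervalLength u c i * intervalLength u c j
    else 0) +
  ∑ i, if IsInner u i then (c i.succ : ℕ) else 0

open Classical in
/-- The set of vertices `C_(a)`: the union of the intervals `[n_{i-1}, n_i]` with `u(i) = a`. -/
noncomputable def cutVertices (a : Fin r) : Finset (Fin (k + 1)) :=
  (Finset.univ.filter fun i => u.get i = a).biUnion fun i => Finset.Icc (c i.castSucc) (c i.succ)

/-- No vertex appears twice in `C_(a)`. -/
def CutNondegenerate (a : Fin r) : Prop :=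
  ∀ i j, i < j → u.get i = a → u.get j = a → c i.succ < c j.castSucc

open Classical in
/-- The class in `Ñ_p(X)` of the face of `x` spanned by the vertices in `S`. -/
noncomputable def faceCls (X : PSSet.{u}) (x : X.sset _⦋k⦌) (S : Finset (Fin (k + 1))) (p : ℤ) :
    Cell X p →₀ R :=
  if h : S.Nonempty then
    cls R X p (X.sset.map (SimplexCategory.mkHom (n := S.card - 1) (m := k)
      (S.orderEmbOfFin (Nat.sub_add_cancel h.card_pos).symm).toOrderHom).op x)
  else 0

open Classical in
/-- The component in `Ñ_{p_1}(X) ⊗ … ⊗ Ñ_{p_r}(X)` of the interval cut coproduct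
`u(x) = ∑ ± x(Δ(C_(1))) ⊗ … ⊗ x(Δ(C_(r)))`. -/
noncomputable def intervalCut (X : PSSet.{u}) (x : X.sset _⦋k⦌) (p : Fin r → ℤ) :
    ⨂[R] i, (Cell X (p i) →₀ R) :=
  ∑ c ∈ cuts u.length k, (-1 : R) ^ cutSign u c • ⨂ₜ[R] a,
    if CutNondegenerate u c a then faceCls R X x (cutVertices u c a) (p a) else 0

/-- The `X_∞`-coalgebra structure of `Ñ_*(X)`. -/
noncomputable def chainsCoops (X : PSSet.{u}) : Coops (SurjOp R) (chains R X) := fun r d =>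
  Finsupp.linearCombination R fun u : SurjSeq r d => fun n p =>
    Finsupp.linearCombination R fun s : Cell X n => intervalCut R u.seq X s.x p

/-- The `X_∞`-algebra structure of `Ñ^*(X)`. -/
noncomputable def cochainsOps (X : PSSet.{u}) : Ops (SurjOp R) (cochains R X) :=
  (chainsCoops R X).dual

/-- The `E_∞`-coalgebra structure of `Ñ_*(X)`. -/
noncomputable def chainsCoopsBE (X : PSSet.{u}) : Coops (BarrattEccles R) (chains R X) :=
  (chainsCoops R X).pullback (tableReduction R)

/-- The `E_∞`-algebra structure of `Ñ^*(X)`. -/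
noncomputable def cochainsOpsBE (X : PSSet.{u}) : Ops (BarrattEccles R) (cochains R X) :=
  (cochainsOps R X).pullback (tableReduction R)

end IntervalCut

end EInftySusp

open EInftySusp

/-! A simplex `(x, 1)` of `ΣX` is `x` with one extra initial vertex, the cone point. Since `(x, j)`
is a degeneracy of `(x, j - 1)` for `j ≥ 2`, the non-degenerate simplices of `ΣX` other than the
base vertex are exactly the `(x, 1)` with `x` such a simplex of `X` (`Cell.susp_bijective`). The
face opposite to the cone point is collapsed, and the index shift in the other faces gives the sign
`-1` in the differential of `s Ñ_*(X)` (`bd_suspSimplex`).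

For the cooperations, a face of `(x, 1)` has class `0` if it omits the cone point or consists of it
alone. A term of `u(x, 1)` thus survives only if every `C_(a)` contains vertex `0`, and it does so
exactly once. So exactly `r` intervals start at `0`, and their values form a permutation: `u` begins
with a permutation, the first `r - 1` intervals are `[0, 0]`, and what remains is a cut of `x` for
`(u(r), …, u(r + d))` (`exists_liftCut_of_cutFactor_ne_zero`). This is the sequence in `σ(u)`. The
signs agree by `cutSign_liftCut`: inversions among the first `r` entries give `sgn`, the trivial
intervals passing the later ones give `∑ |x_i| (r - i)`, and the shift of the end points of inner
intervals gives `|σ(u)|`. The result is `intervalCut_cone`.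

The case of `E_∞` follows because table reduction commutes with `σ` (`sigmaSurj_tableReduction`): if
one of the first `r - 1` rows has length at least two, its first entry never recurs, and the table
is killed by `σ`.

Part (b) is dual to (a). The signs on the two sides agree in the total degree where the cooperation
can be nonzero, and homogeneity disposes of all other degrees (`SuspCompatible.isAlgHom`). -/

namespace EInftySusp

/-! ### Non-degenerate simplices of the suspension -/

namespace PSSet

theorem suspSimplex_eq_some (X : PSSet.{u}) {n j k : ℕ} (h : j + k = n) {x : X.sset _⦋k⦌}
    (hj : 1 ≤ j) (hx : x ≠ X.base k) : X.suspSimplex j k h x = some ⟨j, k, hj, h, x, hx⟩ :=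
  dif_pos ⟨hj, hx⟩

theorem suspSimplex_base (X : PSSet.{u}) {n j k : ℕ} (h : j + k = n) :
    X.suspSimplex j k h (X.base k) = none :=
  dif_neg fun h' => h'.2 rfl

theorem susp_map_mkHom (X : PSSet.{u}) {m n : ℕ} (α : Fin (m + 1) →o Fin (n + 1))
    (t : Option (SuspCell X n)) :
    X.susp.sset.map (SimplexCategory.mkHom α).op t = X.suspMap α t := rfl

/-- The restriction of `(x, j)` along `α`, when the head of `α` has length `c` and the tail of `α`
is `β`. -/
theorem suspMap_suspSimplex_eq (X : PSSet.{u}) {m n j k c l : ℕ} (α : Fin (m + 1) →o Fin (n + 1))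
    (h : j + k = n) (h' : c + l = m) (x : X.sset _⦋k⦌) (β : Fin (l + 1) →o Fin (k + 1))
    (hc : ∀ i : Fin (m + 1), (i : ℕ) < c ↔ (α i : ℕ) < j)
    (hβ : ∀ i : Fin (l + 1), (α ⟨c + i, by omega⟩ : ℕ) = j + β i) :
    X.suspMap α (X.suspSimplex j k h x) =
      X.suspSimplex c l h' (X.sset.map (SimplexCategory.mkHom β).op x) := by
  have hz : headLen α j = c := headLen_eq _ _ _ (by omega) hc
  rw [suspMap_suspSimplex, dif_pos (by omega)]
  refine X.suspSimplex_congr _ _ x _ _ hz fun i hi hi' => ?_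
  subst hz
  have : (α ⟨headLen α j + i, by omega⟩ : ℕ) = j + β ⟨i, hi'⟩ := hβ ⟨i, hi'⟩
  ext
  change (α ⟨headLen α j + i, _⟩ : ℕ) - j = β ⟨i, hi'⟩
  omega

theorem suspMap_eq_none (X : PSSet.{u}) {m n j k : ℕ} (α : Fin (m + 1) →o Fin (n + 1))
    (h : j + k = n) (x : X.sset _⦋k⦌) (hα : ∀ i : Fin (m + 1), (α i : ℕ) < j) :
    X.suspMap α (X.suspSimplex j k h x) = none := by
  have hz : headLen α j = m + 1 :=
    headLen_eq _ _ _ le_rfl fun i => ⟨fun _ => hα i, fun _ => i.isLt⟩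
  rw [suspMap_suspSimplex, dif_neg (by omega)]

theorem suspMap_eq_none_of_le (X : PSSet.{u}) {m n j k : ℕ} (α : Fin (m + 1) →o Fin (n + 1))
    (h : j + k = n) (x : X.sset _⦋k⦌) (hα : ∀ i : Fin (m + 1), j ≤ (α i : ℕ)) :
    X.suspMap α (X.suspSimplex j k h x) = none := by
  have hz : headLen α j = 0 :=
    headLen_eq _ _ _ (by omega) fun i =>
      ⟨fun h => absurd h (by omega), fun h => absurd (hα i) (by omega)⟩
  rw [suspMap_suspSimplex, dif_pos (by omega)]
  exact dif_neg fun h' => absurd h'.1 (by omega)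

/-- The monotone map `[m + 1] → [n + 1]` fixing `0` that is a given map on the remaining
elements. -/
def consHom {m n : ℕ} (f : Fin (m + 1) →o Fin (n + 1)) : Fin (m + 2) →o Fin (n + 2) where
  toFun := Fin.cons 0 fun i => (f i).succ
  monotone' := by
    intro a b hab
    induction a using Fin.cases with
    | zero => simp
    | succ a =>
      induction b using Fin.cases with
      | zero => simp at hab
      | succ b => simpa using f.monotone (Fin.succ_le_succ_iff.mp hab)

/-- This is `(x, j + 1) = s_0 (x, j)` for `j ≥ 1`. -/
theorem suspSimplex_degenerate_of_two_le (X : PSSet.{u}) {n j k : ℕ} (h : j + k = n)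
    (x : X.sset _⦋k⦌) (hj : 2 ≤ j) :
    (X.suspSimplex j k h x : X.susp.sset _⦋n⦌) ∈ X.susp.sset.degenerate n := by
  obtain ⟨j, rfl⟩ : ∃ i, j = i + 1 := ⟨j - 1, by omega⟩
  obtain ⟨n, rfl⟩ : ∃ i, n = i + 1 := ⟨n - 1, by omega⟩
  -- Truncated subtraction sends both `0` and `1` to `0`, so this is the codegeneracy of index `0`.
  let α : Fin (n + 2) →o Fin (n + 1) :=
    ⟨fun i => ⟨(i : ℕ) - 1, by omega⟩, fun a b hab => by
      simp only [Fin.mk_le_mk]; have : (a : ℕ) ≤ b := hab; omega⟩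
  refine ⟨n, by omega, SimplexCategory.mkHom α, X.suspSimplex (n := n) j k (by omega) x, ?_⟩
  rw [susp_map_mkHom, X.suspMap_suspSimplex_eq (c := j + 1) (l := k) α _ (by omega) x OrderHom.id]
  · have : SimplexCategory.mkHom (OrderHom.id : Fin (k + 1) →o Fin (k + 1)) = 𝟙 ⦋k⦌ := rfl
    rw [this]
    simp
    rfl
  · intro i
    change _ ↔ (i : ℕ) - 1 < j
    omega
  · intro i
    change j + 1 + (i : ℕ) - 1 = j + i
    omega

/-- If `x` is the restriction of `y` along `f`, then `(x, 1)` is the restriction of `(y, 1)` along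
`consHom f`. -/
theorem suspSimplex_one_degenerate (X : PSSet.{u}) {n k : ℕ} (h : 1 + k = n)
    (x : X.sset _⦋k⦌) (hx : x ∈ X.sset.degenerate k) :
    (X.suspSimplex 1 k h x : X.susp.sset _⦋n⦌) ∈ X.susp.sset.degenerate n := by
  obtain rfl : n = k + 1 := by omega
  obtain ⟨m, hm, f, y, rfl⟩ := hx
  refine ⟨m + 1, by omega, SimplexCategory.mkHom (consHom f.toOrderHom),
    X.suspSimplex (n := m + 1) 1 m (by omega) y, ?_⟩
  rw [susp_map_mkHom, X.suspMap_suspSimplex_eq (c := 1) (l := k) _ _ (by omega) y f.toOrderHom]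
  · rfl
  · intro i
    change _ ↔ ((Fin.cons 0 (fun i => (f.toOrderHom i).succ) : Fin (k + 2) → Fin (m + 2)) i : ℕ) < 1
    induction i using Fin.cases <;> simp
  · intro i
    have : (⟨1 + i, by omega⟩ : Fin (k + 1 + 1)) = i.succ := by ext; simp; omega
    rw [this]
    change ((Fin.cons 0 (fun i => (f.toOrderHom i).succ) : Fin (k + 2) → Fin (m + 2)) i.succ : ℕ) = _
    rw [Fin.cons_succ, Fin.val_succ, add_comm]

/-- If `(x, 1)` is the restriction of some `(y, j)` along `f`, then `x` is the restriction of `y`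
along the tail of `f`, so it remains to compare dimensions. -/
theorem degenerate_of_suspSimplex_one (X : PSSet.{u}) {n k : ℕ} (h : 1 + k = n)
    (x : X.sset _⦋k⦌) (hx : x ≠ X.base k)
    (hd : (X.suspSimplex 1 k h x : X.susp.sset _⦋n⦌) ∈ X.susp.sset.degenerate n) :
    x ∈ X.sset.degenerate k := by
  obtain ⟨m, hm, f, t, ht⟩ := hd
  change X.suspMap f.toOrderHom t = _ at ht
  rw [suspSimplex_eq_some X h le_rfl hx] at ht
  rcases t with _ | ⟨j, l, h1, h2, y, hy⟩
  · cases ht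
  rw [← suspSimplex_eq_some X h2 h1 hy, suspMap_suspSimplex] at ht
  split_ifs at ht with h3
  · unfold suspSimplex at ht
    split_ifs at ht with h4
    have h5 := Option.some.inj ht
    -- The head of `f` has length `1`, while `j ≥ 1`; hence `l = m - j < n - 1`.
    have h6 : headLen f.toOrderHom j = 1 := congrArg SuspCell.j h5
    rw [SuspCell.mk.injEq] at h5
    obtain ⟨-, h7, h8⟩ := h5
    subst h7
    rw [← eq_of_heq h8]
    refine ⟨l, ?_, _, y, rfl⟩
    have h9 : j + l = m := h2
    change l < n - headLen f.toOrderHom j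
    omega

end PSSet

/-! ### The isomorphism of graded modules and the differential -/

section

variable (R : Type v) [CommRing R]

/-- The cell `(x, 1)` of `ΣX`. -/
noncomputable def Cell.susp {X : PSSet.{u}} {m n : ℤ} (h : m + 1 = n) (s : Cell X m) :
    Cell X.susp n where
  dim := 1 + s.dim
  x := X.inSusp 1 s.x
  dim_eq := by have := s.dim_eq; omega
  nondeg hd := s.nondeg (X.degenerate_of_suspSimplex_one rfl s.x s.ne_base hd)
  ne_base := by
    rw [PSSet.inSusp, X.suspSimplex_eq_some rfl le_rfl s.ne_base]
    exact Option.some_ne_none _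

/-- Surjectivity holds because cells with `j ≥ 2` are degenerate, and those with `j = 1` are
degenerate when `x` is. -/
theorem Cell.susp_bijective (X : PSSet.{u}) {m n : ℤ} (h : m + 1 = n) :
    Function.Bijective (Cell.susp (X := X) h) := by
  constructor
  · rintro ⟨k, x, h1, h2, h3⟩ ⟨k', x', h1', h2', h3'⟩ he
    obtain rfl : k = k' := by omega
    have := (Cell.mk.inj he).2
    have := eq_of_heq this
    rw [PSSet.inSusp, PSSet.inSusp, X.suspSimplex_eq_some rfl le_rfl h3,
      X.suspSimplex_eq_some rfl le_rfl h3'] at this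
    have := eq_of_heq (PSSet.SuspCell.mk.inj (Option.some.inj this)).2.2
    change x = x' at this
    subst this
    rfl
  · rintro ⟨K, t, h1, h2, h3⟩
    rcases t with _ | ⟨j, k, h4, h5, x, h6⟩
    · exact absurd rfl h3
    have h7 := X.suspSimplex_eq_some h5 h4 h6
    obtain rfl : j = 1 := by
      by_contra hj
      refine h2 ?_
      rw [← h7]
      exact X.suspSimplex_degenerate_of_two_le h5 x (by omega)
    change 1 + k = K at h5
    subst h5
    refine ⟨⟨k, x, by push_cast at h1; omega, fun hd => h2 ?_, h6⟩, ?_⟩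
    · rw [← h7]
      exact X.suspSimplex_one_degenerate rfl x hd
    · simp only [Cell.susp, PSSet.inSusp, h7]

/-- The isomorphism `Ñ_m(X) ≅ Ñ_{m+1}(ΣX)`, `x ↦ (x, 1)`. -/
noncomputable def suspLinEquiv (X : PSSet.{u}) {m n : ℤ} (h : m + 1 = n) :
    (Cell X m →₀ R) ≃ₗ[R] (Cell X.susp n →₀ R) :=
  Finsupp.domLCongr (Equiv.ofBijective _ (Cell.susp_bijective X h))

theorem suspLinEquiv_single (X : PSSet.{u}) {m n : ℤ} (h : m + 1 = n) (s : Cell X m) (a : R) :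
    suspLinEquiv R X h (Finsupp.single s a) = Finsupp.single (s.susp h) a := by
  simp [suspLinEquiv]

/-- The formula holds for every simplex, not only for basis elements, because `x ↦ (x, 1)` preserves
degenerate simplices and base simplices. -/
theorem suspLinEquiv_cls (X : PSSet.{u}) {m n : ℤ} (h : m + 1 = n) {k K : ℕ} (hK : 1 + k = K)
    (x : X.sset _⦋k⦌) :
    suspLinEquiv R X h (cls R X m x) =
      cls R X.susp n (k := K) (X.suspSimplex (n := K) 1 k hK x) := by
  subst hK
  by_cases h0 : (k : ℤ) = m ∧ x ∈ X.sset.nonDegenerate k ∧ x ≠ X.base k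
  · have h1 := cls_cell (R := R) X m ⟨k, x, h0.1, h0.2.1, h0.2.2⟩
    have h2 := cls_cell (R := R) X.susp n (Cell.susp h ⟨k, x, h0.1, h0.2.1, h0.2.2⟩)
    dsimp only at h1
    rw [h1, suspLinEquiv_single, ← h2]
    rfl
  · have : cls R X m x = 0 := dif_neg h0
    rw [this, map_zero]
    symm
    by_cases h1 : (k : ℤ) = m
    · by_cases h2 : x ∈ X.sset.nonDegenerate k
      · have h3 : x = X.base k := by
          by_contra h3
          exact h0 ⟨h1, h2, h3⟩
        rw [h3, X.suspSimplex_base]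
        exact cls_base X.susp n (1 + k)
      · exact cls_degenerate X.susp n _ (X.suspSimplex_one_degenerate rfl x (not_not.mp h2))
    · exact cls_of_ne X.susp n _ (by push_cast; omega)

/-- The face `d_0 (x, 1) = (x, 0)` is the base simplex, and `d_{i+1} (x, 1) = (d_i x, 1)` when `x`
is not a vertex; the shift of the index is the sign. -/
theorem bd_suspSimplex (X : PSSet.{u}) {i j : ℤ} (hi : i + 1 = j) {k K : ℕ} (hK : 1 + k = K)
    (x : X.sset _⦋k⦌) :
    bd R X.susp j K (X.suspSimplex 1 k hK x) = -suspLinEquiv R X hi (bd R X i k x) := by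
  obtain rfl : K = k + 1 := by omega
  change ∑ a : Fin (k + 2), (-1 : R) ^ (a : ℕ) •
    cls R X.susp j (X.suspMap (SimplexCategory.δ a).toOrderHom (X.suspSimplex 1 k hK x)) = _
  rw [Fin.sum_univ_succ]
  have h0 : X.suspMap (SimplexCategory.δ (n := k) 0).toOrderHom (X.suspSimplex 1 k hK x) = none :=
    X.suspMap_eq_none_of_le _ hK x fun i => by
      change 1 ≤ ((Fin.succAbove 0 i : Fin (k + 2)) : ℕ)
      simp
  rw [h0]
  have hb : cls R X.susp j (none : Option (PSSet.SuspCell X k)) = 0 := cls_base X.susp j k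
  rw [hb, smul_zero, zero_add]
  cases k with
  | zero =>
    -- For a vertex `x` the remaining face `d_1 (x, 1)` is the cone point, which is identified with
    -- the base point.
    have h1 : X.suspMap (SimplexCategory.δ (n := 0) (Fin.succ 0)).toOrderHom
        (X.suspSimplex 1 0 hK x) = none :=
      X.suspMap_eq_none _ hK x fun i => by
        change ((Fin.succAbove (Fin.succ 0) i : Fin 2) : ℕ) < 1
        fin_cases i; simp
    rw [Fintype.sum_eq_single (0 : Fin 1) fun a ha => absurd (Subsingleton.elim _ _) ha, h1, hb,
      smul_zero]
    simp [bd]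
  | succ l =>
    change _ = -suspLinEquiv R X hi
      (∑ a : Fin (l + 2), (-1 : R) ^ (a : ℕ) • cls R X i (X.sset.δ a x))
    rw [map_sum, ← Finset.sum_neg_distrib]
    refine Finset.sum_congr rfl fun a _ => ?_
    rw [map_smul, suspLinEquiv_cls R X hi (K := l + 1) (add_comm 1 l), Fin.val_succ, pow_succ,
      mul_neg_one, neg_smul]
    congr 3
    refine (X.suspMap_suspSimplex_eq (c := 1) (l := l) _ hK (add_comm 1 l) x
      (SimplexCategory.δ a).toOrderHom ?_ ?_)
    · intro b
      change _ ↔ ((Fin.succAbove a.succ b : Fin (l + 3)) : ℕ) < 1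
      induction b using Fin.cases with
      | zero => simp
      | succ b => simp
    · intro b
      have e : (⟨1 + b, by omega⟩ : Fin (l + 1 + 1)) = b.succ := by ext; simp; omega
      change ((Fin.succAbove a.succ (⟨1 + b, by omega⟩ : Fin (l + 1 + 1)) : Fin (l + 3)) : ℕ) =
        1 + ((Fin.succAbove a b : Fin (l + 2)) : ℕ)
      rw [e, Fin.succ_succAbove_succ, Fin.val_succ, add_comm]

theorem suspLinEquiv_chainsD (X : PSSet.{u}) {i j i' j' : ℤ} (hi : i + 1 = i') (hj : j + 1 = j')
    (z : Cell X i →₀ R) :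
    chainsD R X.susp i' j' (suspLinEquiv R X hi z) = -suspLinEquiv R X hj (chainsD R X i j z) := by
  induction z using Finsupp.induction_linear with
  | zero => simp
  | add f g hf hg => rw [map_add, map_add, hf, hg, map_add, map_add, neg_add]
  | single s a =>
    rw [suspLinEquiv_single, chainsD, chainsD, Finsupp.linearCombination_single,
      Finsupp.linearCombination_single, map_smul, ← smul_neg]
    congr 1
    exact bd_suspSimplex R X hj rfl s.x

theorem suspLinEquiv_natural {X Y : PSSet.{u}} (f : X.Hom Y) {m n : ℤ} (h : m + 1 = n)
    (z : Cell X m →₀ R) :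
    suspLinEquiv R Y h (Finsupp.linearCombination R
        (fun s : Cell X m => cls R Y m (f.map.app (op ⦋s.dim⦌) s.x)) z) =
      Finsupp.linearCombination R
        (fun s : Cell X.susp n => cls R Y.susp n (f.susp.map.app (op ⦋s.dim⦌) s.x))
        (suspLinEquiv R X h z) := by
  induction z using Finsupp.induction_linear with
  | zero => simp
  | add f g hf hg => rw [map_add, map_add, hf, hg, map_add, map_add]
  | single s a =>
    rw [suspLinEquiv_single, Finsupp.linearCombination_single, Finsupp.linearCombination_single,
      map_smul, suspLinEquiv_cls R Y h rfl]
    congr 2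
    exact (f.suspFun_suspSimplex rfl s.x).symm

end

end EInftySusp

/-! ### Faces of `(x, 1)` -/

namespace EInftySusp

namespace PSSet

/-- `(x, 1)` as a simplex of `ΣX` of dimension `n = 1 + k`. -/
noncomputable def cone (X : PSSet.{u}) {k n : ℕ} (h : 1 + k = n) (x : X.sset _⦋k⦌) :
    X.susp.sset _⦋n⦌ :=
  X.suspSimplex 1 k h x

/-- The condition `hβ` sends all vertices after `0` to positive ones, so the head of `α` is just the
vertex `0`. -/
theorem map_cone (X : PSSet.{u}) {m n k l : ℕ} (α : Fin (m + 1) →o Fin (n + 1))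
    (h : 1 + k = n) (h' : 1 + l = m) (x : X.sset _⦋k⦌) (β : Fin (l + 1) →o Fin (k + 1))
    (h0 : α 0 = 0) (hβ : ∀ i : Fin (l + 1), (α ⟨1 + i, by omega⟩ : ℕ) = 1 + β i) :
    X.susp.sset.map (SimplexCategory.mkHom α).op (X.cone h x) =
      X.cone h' (X.sset.map (SimplexCategory.mkHom β).op x) := by
  refine X.suspMap_suspSimplex_eq (c := 1) (l := l) α h h' x β (fun i => ?_) hβ
  subst h'
  rcases Nat.eq_zero_or_pos i with hi | hi
  · obtain rfl : i = 0 := Fin.ext hi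
    simp [h0]
  · have := hβ ⟨(i : ℕ) - 1, by omega⟩
    have e : (⟨1 + ((⟨(i : ℕ) - 1, by omega⟩ : Fin (l + 1)) : ℕ), by omega⟩ : Fin (1 + l + 1)) = i :=
      Fin.ext (by simp only; omega)
    rw [e] at this
    omega

theorem map_cone_eq_base (X : PSSet.{u}) {m n k : ℕ} (α : Fin (m + 1) →o Fin (n + 1))
    (h : 1 + k = n) (x : X.sset _⦋k⦌) (hα : ∀ i, α i = 0) :
    X.susp.sset.map (SimplexCategory.mkHom α).op (X.cone h x) = X.susp.base m :=
  X.suspMap_eq_none α h x fun i => by simp [hα]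

/-- Such a face lies in the copy `(x, 0)` of `X` at the end of the cone, which is collapsed. -/
theorem map_cone_eq_base_of_ne (X : PSSet.{u}) {m n k : ℕ} (α : Fin (m + 1) →o Fin (n + 1))
    (h : 1 + k = n) (x : X.sset _⦋k⦌) (hα : ∀ i, α i ≠ 0) :
    X.susp.sset.map (SimplexCategory.mkHom α).op (X.cone h x) = X.susp.base m :=
  X.suspMap_eq_none_of_le α h x fun i => Nat.one_le_iff_ne_zero.mpr fun h => hα i (Fin.ext h)

end PSSet

section

variable (R : Type v) [CommRing R]

theorem faceCls_eq (X : PSSet.{u}) {k l : ℕ} (x : X.sset _⦋k⦌) (S : Finset (Fin (k + 1)))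
    (h : S.card = l + 1) (p : ℤ) :
    faceCls R X x S p = cls R X p (X.sset.map (SimplexCategory.mkHom (n := l) (m := k)
      (S.orderEmbOfFin h).toOrderHom).op x) := by
  obtain rfl : l = S.card - 1 := by omega
  exact dif_pos (Finset.card_pos.mp (by omega))

theorem faceCls_empty (X : PSSet.{u}) {k : ℕ} (x : X.sset _⦋k⦌) (p : ℤ) :
    faceCls R X x ∅ p = 0 :=
  dif_neg (by simp)

theorem faceCls_of_ne (X : PSSet.{u}) {k : ℕ} (x : X.sset _⦋k⦌) (S : Finset (Fin (k + 1)))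
    {p : ℤ} (h : (S.card : ℤ) ≠ p + 1) : faceCls R X x S p = 0 := by
  rcases S.eq_empty_or_nonempty with rfl | hS
  · exact faceCls_empty R X x p
  · have := hS.card_pos
    rw [faceCls_eq R X x S (l := S.card - 1) (by omega)]
    exact cls_of_ne X p _ (by omega)

/-- The vertices of a face of `(x, 1)` other than the cone point, as vertices of `x`. -/
def tailSet {k : ℕ} (S : Finset (Fin (k + 2))) : Finset (Fin (k + 1)) :=
  Finset.univ.filter fun i => i.succ ∈ S

@[simp]
theorem mem_tailSet {k : ℕ} (S : Finset (Fin (k + 2))) (i : Fin (k + 1)) :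
    i ∈ tailSet S ↔ i.succ ∈ S := by
  simp [tailSet]

theorem card_tailSet {k : ℕ} (S : Finset (Fin (k + 2))) (h0 : 0 ∈ S) :
    S.card = (tailSet S).card + 1 := by
  have : S = Finset.cons 0 ((tailSet S).map (Fin.succEmb _)) (by simp) := by
    ext i
    induction i using Fin.cases <;> simp [h0]
  conv_lhs => rw [this]
  simp

theorem orderEmbOfFin_tailSet {k l : ℕ} (S : Finset (Fin (k + 2))) (h0 : 0 ∈ S)
    (h : (tailSet S).card = l + 1) (h' : S.card = l + 1 + 1) :
    ⇑(S.orderEmbOfFin h') = Fin.cons 0 fun i => ((tailSet S).orderEmbOfFin h i).succ := by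
  symm
  refine Finset.orderEmbOfFin_unique h' ?_ ?_
  · intro i
    induction i using Fin.cases with
    | zero => simpa
    | succ i =>
      rw [Fin.cons_succ, ← mem_tailSet]
      exact Finset.orderEmbOfFin_mem _ _ _
  · intro a b hab
    induction b using Fin.cases with
    | zero => exact absurd hab (by simp)
    | succ b =>
      induction a using Fin.cases with
      | zero => simp
      | succ a => simpa using hab

theorem suspLinEquiv_cls_cone (X : PSSet.{u}) {m n : ℤ} (h : m + 1 = n) {k K : ℕ}
    (hK : 1 + k = K) (x : X.sset _⦋k⦌) :
    suspLinEquiv R X h (cls R X m x) = cls R X.susp n (X.cone hK x) :=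
  suspLinEquiv_cls R X h hK x

theorem faceCls_cone_of_notMem (X : PSSet.{u}) {k : ℕ} (h : 1 + k = k + 1)
    (x : X.sset _⦋k⦌) (S : Finset (Fin (k + 2))) (h0 : 0 ∉ S) (p : ℤ) :
    faceCls R X.susp (X.cone h x) S p = 0 := by
  rcases S.eq_empty_or_nonempty with rfl | hS
  · exact faceCls_empty R _ _ p
  · have hc : S.card = S.card - 1 + 1 := (Nat.sub_add_cancel hS.card_pos).symm
    rw [faceCls_eq R _ _ S hc, X.map_cone_eq_base_of_ne, cls_base]
    intro i hi
    have h1 : S.orderEmbOfFin hc i ∈ S := Finset.orderEmbOfFin_mem _ _ _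
    exact h0 (by rwa [show S.orderEmbOfFin hc i = 0 from hi] at h1)

/-- Removing the cone point from `S` leaves the vertices of a face of `x`, shifted by one. For `S =
{0}` both sides vanish: the left one is the cone point, the right one an empty face. -/
theorem faceCls_cone (X : PSSet.{u}) {k : ℕ} (h : 1 + k = k + 1)
    (x : X.sset _⦋k⦌) (S : Finset (Fin (k + 2))) (h0 : 0 ∈ S) {m n : ℤ} (hmn : m + 1 = n) :
    faceCls R X.susp (X.cone h x) S n =
      suspLinEquiv R X hmn (faceCls R X x (tailSet S) m) := by
  have hc := card_tailSet S h0
  rcases (tailSet S).eq_empty_or_nonempty with hT | hT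
  · rw [hT, Finset.card_empty] at hc
    rw [hT, faceCls_empty, map_zero, faceCls_eq R _ _ S hc, X.map_cone_eq_base, cls_base]
    intro i
    obtain ⟨a, ha⟩ := Finset.card_eq_one.mp hc
    have h1 : S.orderEmbOfFin hc i ∈ S := Finset.orderEmbOfFin_mem _ _ _
    change S.orderEmbOfFin hc i = 0
    rw [ha, Finset.mem_singleton] at h0
    generalize S.orderEmbOfFin hc i = b at h1
    rw [ha, Finset.mem_singleton] at h1
    rw [h1, h0]
  · obtain ⟨l, hl⟩ : ∃ l, (tailSet S).card = l + 1 :=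
      ⟨_, (Nat.sub_add_cancel hT.card_pos).symm⟩
    have hS : S.card = l + 1 + 1 := by omega
    have he := orderEmbOfFin_tailSet S h0 hl hS
    rw [faceCls_eq R _ _ S hS, faceCls_eq R X x _ hl,
      suspLinEquiv_cls_cone R X hmn (add_comm 1 l),
      X.map_cone _ h (add_comm 1 l) x ((tailSet S).orderEmbOfFin hl).toOrderHom]
    · exact congrFun he 0
    · intro b
      have e : (⟨1 + b, by omega⟩ : Fin (l + 1 + 1)) = b.succ := by ext; simp; omega
      change ((S.orderEmbOfFin hS (⟨1 + b, by omega⟩ : Fin (l + 1 + 1)) : Fin (k + 2)) : ℕ) =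
        1 + (((tailSet S).orderEmbOfFin hl b : Fin (k + 1)) : ℕ)
      rw [e, he, Fin.cons_succ, Fin.val_succ, add_comm]

end

end EInftySusp

namespace EInftySusp

/-! ### Lengths of the intervals of a cut -/

section Lengths

variable {r : ℕ} (u : List (Fin r)) {k : ℕ} (c : Fin (u.length + 1) → Fin (k + 1))

open Classical in
-- The last occurrence of `a` is the unique final interval with this value.
theorem sum_final {a : Fin r} (ha : a ∈ u) :
    ∑ j : Fin u.length, (if u.get j = a ∧ ¬IsInner u j then 1 else 0) = 1 := by
  obtain ⟨i, hi⟩ := List.mem_iff_get.mp ha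
  have hne : (Finset.univ.filter fun j : Fin u.length => u.get j = a).Nonempty :=
    ⟨i, by simpa using hi⟩
  let t := (Finset.univ.filter fun j : Fin u.length => u.get j = a).max' hne
  have ht : u.get t = a := (Finset.mem_filter.mp (Finset.max'_mem _ hne)).2
  have hmax : ∀ j, u.get j = a → j ≤ t := fun j hj =>
    Finset.le_max' _ j (Finset.mem_filter.mpr ⟨Finset.mem_univ _, hj⟩)
  rw [Fintype.sum_eq_single t, if_pos]
  · refine ⟨ht, ?_⟩
    rintro ⟨j, hj, hj'⟩
    exact absurd (hmax j (hj'.trans ht)) (not_le.mpr hj)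
  · intro j hj
    refine if_neg ?_
    rintro ⟨h1, h2⟩
    exact h2 ⟨t, lt_of_le_of_ne (hmax j h1) hj, ht.trans h1.symm⟩

open Classical in
-- Each of the `r` values has exactly one final interval, so the number of inner intervals is the
-- degree of `u`.
theorem sum_isInner (hu : ∀ a, a ∈ u) :
    (∑ j : Fin u.length, if IsInner u j then 1 else 0) + r = u.length := by
  have h1 : ∑ j : Fin u.length, (if ¬IsInner u j then 1 else 0) = r := by
    calc ∑ j : Fin u.length, (if ¬IsInner u j then 1 else 0)
        = ∑ j : Fin u.length, ∑ a, (if u.get j = a ∧ ¬IsInner u j then 1 else 0) := by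
          refine Finset.sum_congr rfl fun j _ => ?_
          simp only [ite_and]
          rw [Finset.sum_ite_eq]
          simp
      _ = ∑ _a : Fin r, 1 := by
          rw [Finset.sum_comm]
          exact Finset.sum_congr rfl fun a _ => sum_final u (hu a)
      _ = r := by simp
  have h2 : ∑ j : Fin u.length, ((if IsInner u j then 1 else 0) + if ¬IsInner u j then 1 else 0) =
      ∑ _j : Fin u.length, 1 :=
    Finset.sum_congr rfl fun j _ => by split_ifs <;> simp_all
  rw [Finset.sum_add_distrib, h1] at h2
  simpa using h2

/-- The number of vertices of an interval is its length if it is inner and its length plus one if it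
is final. Non-degeneracy makes the intervals of value `a` disjoint, and exactly one of them is
final. -/
theorem card_cutVertices (hc : Monotone c) {a : Fin r} (ha : a ∈ u)
    (h : CutNondegenerate u c a) :
    (cutVertices u c a).card =
      (∑ j : Fin u.length, if u.get j = a then intervalLength u c j else 0) + 1 := by
  classical
  have h0 := sum_final u ha
  rw [cutVertices, Finset.card_biUnion, Finset.sum_filter]
  refine Eq.trans ?_ (congrArg (_ + ·) h0)
  rw [← Finset.sum_add_distrib]
  · refine Finset.sum_congr rfl fun j _ => ?_
    have h1 : (c j.castSucc : ℕ) ≤ c j.succ := hc (Fin.castSucc_lt_succ).le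
    by_cases h2 : u.get j = a <;> by_cases h3 : IsInner u j <;>
      simp only [h2, h3, if_true, if_false, Fin.card_Icc, intervalLength, true_and, false_and,
        not_true_eq_false, not_false_eq_true]
    all_goals omega
  · have key : ∀ i j, i < j → u.get i = a → u.get j = a →
        Disjoint (Finset.Icc (c i.castSucc) (c i.succ)) (Finset.Icc (c j.castSucc) (c j.succ)) := by
      intro i j hij hi hj
      have := h i j hij hi hj
      rw [Finset.disjoint_left]
      intro b hb hb'
      rw [Finset.mem_Icc] at hb hb'
      exact absurd (hb.2.trans_lt this) (not_lt.mpr hb'.1)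
    intro i hi j hj hij
    have hi' : u.get i = a := by simpa using hi
    have hj' : u.get j = a := by simpa using hj
    rcases lt_or_gt_of_ne hij with h' | h'
    · exact key i j h' hi' hj'
    · exact (key j i h' hj' hi').symm

open Classical in
theorem sum_intervalLength (hc : c ∈ cuts u.length k) :
    ∑ j, intervalLength u c j = k + ∑ j : Fin u.length, if IsInner u j then 1 else 0 := by
  simp only [cuts, Finset.mem_filter, Finset.mem_univ, true_and] at hc
  obtain ⟨h1, h2, h3⟩ := hc
  simp only [intervalLength, Finset.sum_add_distrib]
  congr 1
  -- The cut is extended by the constant `k`, so that a telescoping sum of a monotone function on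
  -- `ℕ` applies.
  let f : ℕ → ℕ := fun i => if h : i < u.length + 1 then (c ⟨i, h⟩ : ℕ) else k
  have hf : Monotone f := by
    intro a b hab
    simp only [f]
    split_ifs
    · exact h1 (Fin.mk_le_mk.mpr hab)
    · have := (c ⟨a, by assumption⟩).isLt; omega
    · omega
    · exact le_rfl
  have h4 := Finset.sum_range_tsub hf u.length
  rw [← Fin.sum_univ_eq_sum_range (fun i => f (i + 1) - f i)] at h4
  have h5 : f u.length = k := by
    have : c ⟨u.length, by omega⟩ = Fin.last k := h3
    simp [f, this]
  have h6 : f 0 = 0 := by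
    have : c ⟨0, by omega⟩ = 0 := h2
    exact (dif_pos (by omega)).trans (by rw [this, Fin.val_zero])
  rw [h5, h6, Nat.sub_zero] at h4
  refine Eq.trans ?_ h4
  refine Finset.sum_congr rfl fun j _ => ?_
  have h7 : f ((j : ℕ) + 1) = c j.succ := dif_pos (by omega)
  have h8 : f (j : ℕ) = c j.castSucc := dif_pos (by omega)
  rw [h7, h8]

end Lengths

/-! ### Cuts that start with trivial intervals -/

section Lift

variable {m : ℕ} (u : List (Fin (m + 1))) {k : ℕ}

/-- The cut of `[0, k + 1]` with `m` trivial intervals at `0`, followed by the intervals of a given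
cut of `[0, k]`, shifted by one, where the first one is extended to `0`. -/
def liftCut (c : Fin ((u.drop m).length + 1) → Fin (k + 1)) : Fin (u.length + 1) → Fin (k + 2) :=
  fun i => if h : (i : ℕ) ≤ m then 0 else
    (c ⟨i - m, by rw [List.length_drop]; omega⟩).succ

variable (c : Fin ((u.drop m).length + 1) → Fin (k + 1))

theorem liftCut_of_le {i : Fin (u.length + 1)} (h : (i : ℕ) ≤ m) : liftCut u c i = 0 := dif_pos h

theorem liftCut_of_eq {i : Fin (u.length + 1)} {j : Fin ((u.drop m).length + 1)}
    (h : (i : ℕ) = m + j) (hj : j ≠ 0) : liftCut u c i = (c j).succ := by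
  have hj' : (j : ℕ) ≠ 0 := fun h => hj (Fin.ext h)
  have e : (⟨(i : ℕ) - m, by rw [List.length_drop]; omega⟩ : Fin ((u.drop m).length + 1)) = j :=
    Fin.ext (by simp only; omega)
  unfold liftCut
  rw [dif_neg (by omega), e]

/-- The `j`-th entry of `u.drop m`, as an entry of `u`. -/
def dropIdx (j : Fin (u.drop m).length) : Fin u.length :=
  ⟨m + j, by have := j.isLt; have := List.length_drop (i := m) (l := u); omega⟩

theorem get_dropIdx (j : Fin (u.drop m).length) : u.get (dropIdx u j) = (u.drop m).get j := by
  simp [dropIdx]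

theorem lt_or_eq_dropIdx (i : Fin u.length) : (i : ℕ) < m ∨ ∃ j, i = dropIdx u j := by
  rcases Nat.lt_or_ge i m with h | h
  · exact Or.inl h
  · exact Or.inr ⟨⟨i - m, by rw [List.length_drop]; omega⟩, Fin.ext (by simp [dropIdx]; omega)⟩

theorem dropIdx_lt_iff (i j : Fin (u.drop m).length) : dropIdx u i < dropIdx u j ↔ i < j := by
  simp only [dropIdx, Fin.lt_def]; omega

theorem isInner_dropIdx (j : Fin (u.drop m).length) :
    IsInner u (dropIdx u j) ↔ IsInner (u.drop m) j := by
  constructor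
  · rintro ⟨i, hi, h⟩
    rcases lt_or_eq_dropIdx u i with h' | ⟨i, rfl⟩
    · have : m + (j : ℕ) < i := hi
      omega
    · rw [get_dropIdx, get_dropIdx] at h
      exact ⟨i, (dropIdx_lt_iff u _ _).mp hi, h⟩
  · rintro ⟨i, hi, h⟩
    exact ⟨dropIdx u i, (dropIdx_lt_iff u _ _).mpr hi, by rw [get_dropIdx, get_dropIdx, h]⟩

theorem isInner_of_lt (hu : ∀ a, a ∈ u.drop m) (i : Fin u.length) (hi : (i : ℕ) < m) :
    IsInner u i := by
  obtain ⟨j, hj⟩ := List.mem_iff_get.mp (hu (u.get i))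
  exact ⟨dropIdx u j, Fin.lt_def.mpr (by simp only [dropIdx]; omega), by rw [get_dropIdx, hj]⟩

theorem liftCut_succ_of_lt (i : Fin u.length) (hi : (i : ℕ) < m) : liftCut u c i.succ = 0 :=
  liftCut_of_le u c (by rw [Fin.val_succ]; omega)

theorem liftCut_castSucc_of_lt (i : Fin u.length) (hi : (i : ℕ) < m) :
    liftCut u c i.castSucc = 0 :=
  liftCut_of_le u c (by rw [Fin.val_castSucc]; omega)

theorem liftCut_dropIdx_succ (j : Fin (u.drop m).length) :
    liftCut u c (dropIdx u j).succ = (c j.succ).succ :=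
  liftCut_of_eq u c (by simp only [dropIdx, Fin.val_succ]; omega) (Fin.succ_ne_zero j)

theorem liftCut_dropIdx_castSucc (j : Fin (u.drop m).length) (hj : (j : ℕ) ≠ 0) :
    liftCut u c (dropIdx u j).castSucc = (c j.castSucc).succ :=
  liftCut_of_eq u c (by simp only [dropIdx, Fin.val_castSucc]) fun h => hj (Fin.ext_iff.mp h)

theorem liftCut_dropIdx_castSucc_zero (j : Fin (u.drop m).length) (hj : (j : ℕ) = 0) :
    liftCut u c (dropIdx u j).castSucc = 0 :=
  liftCut_of_le u c (by simp only [dropIdx, Fin.val_castSucc]; omega)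

theorem liftCut_mem_cuts (hu : m + 1 ≤ u.length) (hc : c ∈ cuts (u.drop m).length k) :
    liftCut u c ∈ cuts u.length (k + 1) := by
  simp only [cuts, Finset.mem_filter, Finset.mem_univ, true_and] at hc ⊢
  obtain ⟨h1, h2, h3⟩ := hc
  refine ⟨?_, liftCut_of_le u c (by simp), ?_⟩
  · intro a b hab
    have hab' : (a : ℕ) ≤ b := hab
    unfold liftCut
    split_ifs
    · exact le_rfl
    · exact Fin.zero_le _
    · omega
    · exact Fin.succ_le_succ_iff.mpr (h1 (Fin.mk_le_mk.mpr (by omega)))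
  · rw [liftCut_of_eq u c (j := Fin.last _), h3, Fin.succ_last]
    · simp only [Fin.val_last, List.length_drop]; omega
    · refine fun h => ?_
      have := Fin.ext_iff.mp h
      simp only [Fin.val_last, List.length_drop, Fin.val_zero] at this
      omega

/-- The lift forgets only `c 0`, which is `0` for every cut. -/
theorem liftCut_injOn :
    Set.InjOn (liftCut u) (cuts (u.drop m).length k : Set (Fin _ → Fin (k + 1))) := by
  intro c hc c' hc' h
  have hc0 : c 0 = 0 := by simp [cuts] at hc; exact hc.2.1
  have hc0' : c' 0 = 0 := by simp [cuts] at hc'; exact hc'.2.1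
  funext j
  by_cases hj : j = 0
  · rw [hj, hc0, hc0']
  · have hlt : m + (j : ℕ) < u.length + 1 := by
      have h1 := j.isLt
      have h2 : (j : ℕ) ≠ 0 := fun h => hj (Fin.ext h)
      have := List.length_drop (i := m) (l := u)
      omega
    have := congrFun h ⟨m + j, hlt⟩
    rw [liftCut_of_eq u c rfl hj, liftCut_of_eq u c' rfl hj] at this
    exact Fin.succ_injective _ this

theorem exists_liftCut_eq (c : Fin (u.length + 1) → Fin (k + 2)) (hc : c ∈ cuts u.length (k + 1))
    (h : ∀ i, c i = 0 ↔ (i : ℕ) ≤ m) :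
    ∃ c' ∈ cuts (u.drop m).length k, liftCut u c' = c := by
  simp only [cuts, Finset.mem_filter, Finset.mem_univ, true_and] at hc
  obtain ⟨h1, h2, h3⟩ := hc
  have hm : m < u.length := by
    by_contra hm
    have := (h (Fin.last _)).mpr (by simpa using hm)
    rw [h3] at this
    exact absurd this (Fin.last_pos).ne'
  have hl : (u.drop m).length = u.length - m := List.length_drop
  let idx : Fin ((u.drop m).length + 1) → Fin (u.length + 1) := fun j => ⟨m + j, by omega⟩
  -- The entries from position `m` on, lowered by one. The entry at `m` is `0`, and truncated
  -- subtraction keeps it there, as a cut requires.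
  refine ⟨fun j => ⟨(c (idx j) : ℕ) - 1, by have := (c (idx j)).isLt; omega⟩, ?_, ?_⟩
  · simp only [cuts, Finset.mem_filter, Finset.mem_univ, true_and]
    refine ⟨?_, ?_, ?_⟩
    · intro a b hab
      have : c (idx a) ≤ c (idx b) :=
        h1 (Fin.mk_le_mk.mpr (by have : (a : ℕ) ≤ b := hab; omega))
      have : (c (idx a) : ℕ) ≤ c (idx b) := this
      exact Fin.mk_le_mk.mpr (by omega)
    · have : c (idx 0) = 0 := (h _).mpr (by simp [idx])
      ext
      simp [this]
    · have e : idx (Fin.last _) = Fin.last _ :=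
        Fin.ext (by simp only [idx, Fin.val_last]; omega)
      ext
      simp [e, h3]
  · funext i
    by_cases hi : (i : ℕ) ≤ m
    · rw [liftCut_of_le _ _ hi, (h i).mpr hi]
    · have hne : (c i : ℕ) ≠ 0 := fun h0 => hi ((h i).mp (Fin.ext h0))
      rw [liftCut_of_eq u _ (j := ⟨i - m, by omega⟩) (by simp only; omega)
        (fun h0 => by have := Fin.ext_iff.mp h0; simp at this; omega)]
      have e : idx ⟨i - m, by omega⟩ = i := Fin.ext (by simp only [idx]; omega)
      ext
      simp only [e, Fin.val_succ]
      omega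

/-- If every `C_(a)` contains the vertex `0` exactly once, then the sequence starts with a
permutation, and precisely the first intervals start at `0`. -/
theorem take_eq_ofFn_of_zero_mem (c : Fin (u.length + 1) → Fin (k + 2))
    (hc : c ∈ cuts u.length (k + 1)) (h : ∀ a, CutNondegenerate u c a ∧ 0 ∈ cutVertices u c a) :
    (∃ π : Equiv.Perm (Fin (m + 1)), List.ofFn π = u.take (m + 1)) ∧
      ∀ i, c i = 0 ↔ (i : ℕ) ≤ m := by
  simp only [cuts, Finset.mem_filter, Finset.mem_univ, true_and] at hc
  obtain ⟨h1, h2, h3⟩ := hc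
  obtain ⟨z, hlt⟩ : ∃ z, ∀ i : Fin (u.length + 1), (i : ℕ) < z ↔ c i = 0 := by
    -- By monotonicity the cut points equal to `0` form an initial segment; `z` is its length, so
    -- the intervals starting at `0` are those of index less than `z`.
    refine ⟨PSSet.headLen ⟨c, h1⟩ 1, fun i => ?_⟩
    rw [PSSet.lt_headLen, Nat.lt_one_iff, Fin.ext_iff]
    rfl
  have hzN : z ≤ u.length := by
    by_contra hcon
    have := (hlt (Fin.last _)).mp (by rw [Fin.val_last]; omega)
    rw [h3] at this
    exact absurd this (Fin.last_pos).ne'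
  let f : Fin z → Fin (m + 1) := fun i => u.get ⟨i, by omega⟩
  -- Two intervals of the same value starting at `0` would repeat the vertex `0`.
  have hinj : Function.Injective f := by
    have key : ∀ i j : Fin z, i < j → f i ≠ f j := by
      intro i j hij he
      have := (h (f j)).1 ⟨i, by omega⟩ ⟨j, by omega⟩ hij he rfl
      have h0 : c (Fin.castSucc ⟨j, by omega⟩) = 0 := (hlt _).mp j.isLt
      rw [h0] at this
      exact absurd this (Fin.not_lt_zero _)
    intro i j he
    by_contra hne
    rcases lt_or_gt_of_ne hne with h' | h'
    · exact key i j h' he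
    · exact key j i h' he.symm
  -- An interval that contains `0` starts at `0`.
  have hsurj : Function.Surjective f := by
    intro a
    obtain ⟨i, hi, h0⟩ := by
      simpa only [cutVertices, Finset.mem_biUnion, Finset.mem_filter, Finset.mem_univ, true_and,
        Finset.mem_Icc] using (h a).2
    exact ⟨⟨i, (hlt i.castSucc).mpr (le_antisymm h0.1 (Fin.zero_le _))⟩, hi⟩
  have hcard : z = m + 1 := by
    simpa using Fintype.card_of_bijective (f := f) ⟨hinj, hsurj⟩
  subst hcard
  refine ⟨⟨Equiv.ofBijective f ⟨hinj, hsurj⟩, ?_⟩, fun i => by rw [← hlt]; omega⟩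
  refine List.ext_getElem (by simp; omega) fun i hi hi' => ?_
  simp only [List.getElem_ofFn, List.getElem_take, Equiv.ofBijective_apply, f, List.get_eq_getElem]

end Lift

end EInftySusp

namespace EInftySusp

/-! ### Signs -/

/-- The number of inversions of a permutation. -/
def invCount {n : ℕ} (π : Equiv.Perm (Fin n)) : ℕ :=
  ∑ i, ∑ j, if i < j ∧ π j < π i then 1 else 0

theorem neg_one_pow_invCount (R : Type v) [CommRing R] {n : ℕ} (π : Equiv.Perm (Fin n)) :
    (-1 : R) ^ invCount π = ((Equiv.Perm.sign π : ℤ) : R) := by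
  have h : (Equiv.Perm.sign π : ℤ) = (-1) ^ invCount π := by
    rw [Equiv.Perm.sign_eq_prod_prod_Ioi]
    simp only [invCount, Units.coe_prod]
    rw [← Finset.prod_pow_eq_pow_sum]
    refine Finset.prod_congr rfl fun i _ => ?_
    rw [← Finset.prod_pow_eq_pow_sum, ← Finset.prod_subset (Finset.subset_univ (Finset.Ioi i))]
    · refine Finset.prod_congr rfl fun j hj => ?_
      have hij : i < j := Finset.mem_Ioi.mp hj
      rcases lt_or_ge (π i) (π j) with h | h
      · simp [h, h.le.not_gt]
      · have h' : π j < π i := lt_of_le_of_ne h fun e => hij.ne' (π.injective e)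
        simp [h', h'.le.not_gt, hij]
    · intro j _ hj
      have hij : ¬i < j := fun h => hj (Finset.mem_Ioi.mpr h)
      simp [hij]
  rw [h]
  push_cast
  rfl

theorem sgn_ofFn {r : ℕ} (π : Equiv.Perm (Fin r)) :
    sgn (List.ofFn π) = (Equiv.Perm.sign π : ℤ) := by
  unfold sgn
  rw [Fintype.sum_eq_single π, if_pos rfl]
  intro ρ hρ
  exact if_neg fun h => hρ (Equiv.ext (congrFun (List.ofFn_injective h)))

theorem sgn_eq_zero {r : ℕ} {l : List (Fin r)}
    (h : ¬∃ π : Equiv.Perm (Fin r), List.ofFn π = l) : sgn l = 0 :=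
  Finset.sum_eq_zero fun π _ => if_neg fun h' => h ⟨π, h'⟩

theorem ksign_add (R : Type v) [CommRing R] (a b : ℤ) :
    ksign R (a + b) = ksign R a * ksign R b := by
  simp [ksign, Int.negOnePow_add]

theorem ksign_natCast (R : Type v) [CommRing R] (n : ℕ) : ksign R n = (-1) ^ n := by
  simp [ksign, Int.negOnePow_def]

theorem ksign_mul_self (R : Type v) [CommRing R] (a : ℤ) : ksign R a * ksign R a = 1 := by
  rw [← ksign_add]
  simp [ksign, Int.negOnePow_even (a + a) ⟨a, rfl⟩]

theorem ksign_congr (R : Type v) [CommRing R] {a b : ℤ} (c : ℤ) (h : a = b + 2 * c) :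
    ksign R a = ksign R b := by
  rw [h, two_mul, ksign_add, ksign_add, ksign_mul_self, mul_one]

section Lift

variable {m : ℕ} (u : List (Fin (m + 1))) {k : ℕ}
  (c : Fin ((u.drop m).length + 1) → Fin (k + 1))

/-- The `i`-th entry of `u.take m`, as an entry of `u`. -/
def headIdx (hu : m + 1 ≤ u.length) (i : Fin m) : Fin u.length := ⟨i, by omega⟩

/-- The first entry of `u.drop m`. -/
def dropHead (hu : m + 1 ≤ u.length) : Fin (u.drop m).length :=
  ⟨0, by rw [List.length_drop]; omega⟩

theorem sum_headIdx_add_sum_dropIdx {M : Type*} [AddCommMonoid M] (hu : m + 1 ≤ u.length)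
    (f : Fin u.length → M) :
    ∑ i, f i = ∑ i, f (headIdx u hu i) + ∑ j, f (dropIdx u j) := by
  have h : m + (u.drop m).length = u.length := by rw [List.length_drop]; omega
  rw [← Equiv.sum_comp (finCongr h) f, Fin.sum_univ_add]
  rfl

variable {u} {π : Equiv.Perm (Fin (m + 1))}

theorem length_of_ofFn_eq_take (hπ : List.ofFn π = u.take (m + 1)) : m + 1 ≤ u.length := by
  have := congrArg List.length hπ
  simp only [List.length_ofFn, List.length_take] at this
  omega

theorem get_of_ofFn_eq_take (hπ : List.ofFn π = u.take (m + 1)) (i : Fin u.length)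
    (hi : (i : ℕ) < m + 1) : u.get i = π ⟨i, hi⟩ := by
  have := List.getElem_of_eq hπ (i := i) (by simpa using hi)
  simpa only [List.getElem_ofFn, List.getElem_take, List.get_eq_getElem] using this.symm

theorem get_headIdx (hπ : List.ofFn π = u.take (m + 1)) (hu : m + 1 ≤ u.length) (i : Fin m) :
    u.get (headIdx u hu i) = π i.castSucc :=
  get_of_ofFn_eq_take hπ _ (by simp only [headIdx]; omega)

theorem get_dropHead (hπ : List.ofFn π = u.take (m + 1)) (hu : m + 1 ≤ u.length) :
    (u.drop m).get (dropHead u hu) = π (Fin.last m) := by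
  rw [← get_dropIdx, get_of_ofFn_eq_take hπ _ (by simp [dropIdx, dropHead])]
  rfl

theorem dropHead_iff (hu : m + 1 ≤ u.length) (j : Fin (u.drop m).length) :
    (j : ℕ) = 0 ↔ j = dropHead u hu := by
  rw [Fin.ext_iff]
  rfl

/-- The interval `[0, 0]` has length `1` rather than `0` because its value recurs in `u.drop m`,
which makes it inner. -/
theorem intervalLength_headIdx (hs : ∀ a, a ∈ u.drop m) (hu : m + 1 ≤ u.length) (i : Fin m) :
    intervalLength u (liftCut u c) (headIdx u hu i) = 1 := by
  have hi : ((headIdx u hu i : Fin u.length) : ℕ) < m := i.isLt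
  rw [intervalLength, liftCut_succ_of_lt u c _ hi, liftCut_castSucc_of_lt u c _ hi,
    if_pos (isInner_of_lt u hs _ hi)]
  rfl

open Classical in
-- Only the first remaining interval grows: after the shift it would start at `1`, but it is
-- extended back to `0`.
theorem intervalLength_dropIdx (hc : c 0 = 0) (hu : m + 1 ≤ u.length)
    (j : Fin (u.drop m).length) :
    intervalLength u (liftCut u c) (dropIdx u j) =
      intervalLength (u.drop m) c j + if j = dropHead u hu then 1 else 0 := by
  rw [intervalLength, intervalLength, liftCut_dropIdx_succ, isInner_dropIdx]
  by_cases hj : (j : ℕ) = 0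
  · rw [liftCut_dropIdx_castSucc_zero u c j hj, if_pos ((dropHead_iff hu j).mp hj)]
    have : j.castSucc = 0 := Fin.ext hj
    rw [this, hc]
    simp only [Fin.val_succ, Fin.val_zero]
    omega
  · rw [liftCut_dropIdx_castSucc u c j hj, if_neg ((dropHead_iff hu j).not.mp hj)]
    simp only [Fin.val_succ]
    omega

/-- Counts the initial entries that form an inversion with a later entry `a`. As the initial entries
form a permutation, the count depends only on `a`; this produces the coefficients `r - i` in the
suspension sign. -/
theorem sum_lt_eq_sub (π : Equiv.Perm (Fin (m + 1))) (a : Fin (m + 1)) :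
    ∑ i, (if a < π i then 1 else 0) = m - (a : ℕ) := by
  rw [Equiv.sum_comp π fun b => if a < b then 1 else 0, Finset.sum_boole]
  have : (Finset.univ.filter fun b => a < b) = Finset.Ioi a := by ext; simp
  rw [this]
  simp

open Classical in
-- Split the pairs of intervals according to whether each is one of the `m` trivial ones. Trivial
-- pairs count the inversions of `π` among its first `m` entries. A trivial interval and a remaining
-- one contribute the old length of the latter per inversion. The extra unit of length of the first
-- remaining interval supplies the inversions with `π (Fin.last m)`, on both sides of it, which
-- completes `invCount π` and the coefficients `m - u(j)`. The identity holds in `ℕ`, not only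
-- modulo two.
theorem cutSign_liftCut (hπ : List.ofFn π = u.take (m + 1)) (hs : ∀ a, a ∈ u.drop m)
    (hc : c 0 = 0) :
    cutSign u (liftCut u c) = cutSign (u.drop m) c + invCount π +
      ∑ j, intervalLength (u.drop m) c j * (m - ((u.drop m).get j : ℕ)) +
      ∑ j : Fin (u.drop m).length, if IsInner (u.drop m) j then 1 else 0 := by
  have hu := length_of_ofFn_eq_take hπ
  -- In the position sign the trivial intervals end at `0`, and every other end point moves up by
  -- one.
  have hpos : ∑ i : Fin u.length, (if IsInner u i then (liftCut u c i.succ : ℕ) else 0) =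
      (∑ j : Fin (u.drop m).length, if IsInner (u.drop m) j then (c j.succ : ℕ) else 0) +
        ∑ j : Fin (u.drop m).length, if IsInner (u.drop m) j then 1 else 0 := by
    rw [sum_headIdx_add_sum_dropIdx u hu, ← Finset.sum_add_distrib]
    rw [Finset.sum_eq_zero fun i _ => ?_, zero_add]
    · refine Finset.sum_congr rfl fun j _ => ?_
      rw [isInner_dropIdx, liftCut_dropIdx_succ, Fin.val_succ]
      split_ifs <;> rfl
    · rw [liftCut_succ_of_lt u c _ i.isLt]
      simp
  have hHH : ∀ i j : Fin m, (if headIdx u hu i < headIdx u hu j ∧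
      u.get (headIdx u hu j) < u.get (headIdx u hu i) then
        intervalLength u (liftCut u c) (headIdx u hu i) *
          intervalLength u (liftCut u c) (headIdx u hu j) else 0) =
      if i.castSucc < j.castSucc ∧ π j.castSucc < π i.castSucc then 1 else 0 := by
    intro i j
    rw [get_headIdx hπ, get_headIdx hπ, intervalLength_headIdx c hs, intervalLength_headIdx c hs]
    rfl
  have hHD : ∀ (i : Fin m) (j : Fin (u.drop m).length), (if headIdx u hu i < dropIdx u j ∧
      u.get (dropIdx u j) < u.get (headIdx u hu i) then
        intervalLength u (liftCut u c) (headIdx u hu i) *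
          intervalLength u (liftCut u c) (dropIdx u j) else 0) =
      intervalLength (u.drop m) c j * (if (u.drop m).get j < π i.castSucc then 1 else 0) +
        if j = dropHead u hu then (if (u.drop m).get j < π i.castSucc then 1 else 0) else 0 := by
    intro i j
    have h1 : headIdx u hu i < dropIdx u j := by
      simp only [headIdx, dropIdx, Fin.mk_lt_mk]; omega
    rw [get_headIdx hπ, get_dropIdx, intervalLength_headIdx c hs,
      intervalLength_dropIdx c hc hu]
    simp only [h1, true_and, one_mul]
    split_ifs <;> simp
  have hDH : ∀ (i : Fin (u.drop m).length) (j : Fin m), (if dropIdx u i < headIdx u hu j ∧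
      u.get (headIdx u hu j) < u.get (dropIdx u i) then
        intervalLength u (liftCut u c) (dropIdx u i) *
          intervalLength u (liftCut u c) (headIdx u hu j) else 0) = 0 := by
    intro i j
    refine if_neg fun h => ?_
    have := h.1
    simp only [headIdx, dropIdx, Fin.mk_lt_mk] at this
    omega
  have hDD : ∀ i j : Fin (u.drop m).length, (if dropIdx u i < dropIdx u j ∧
      u.get (dropIdx u j) < u.get (dropIdx u i) then
        intervalLength u (liftCut u c) (dropIdx u i) *
          intervalLength u (liftCut u c) (dropIdx u j) else 0) =
      (if i < j ∧ (u.drop m).get j < (u.drop m).get i then intervalLength (u.drop m) c i * intervalLength (u.drop m) c j else 0) +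
        if i = dropHead u hu then (if i < j ∧ (u.drop m).get j < (u.drop m).get i then intervalLength (u.drop m) c j else 0) else 0 := by
    intro i j
    simp only [get_dropIdx, dropIdx_lt_iff, intervalLength_dropIdx c hc hu]
    by_cases h : i < j ∧ (u.drop m).get j < (u.drop m).get i
    · have hj : j ≠ dropHead u hu := by
        rw [Ne, ← dropHead_iff]
        have : (i : ℕ) < j := h.1
        omega
      rw [if_pos h, if_pos h, if_neg hj]
      split_ifs <;> simp [add_mul]
    · simp only [if_neg h, ite_self, add_zero]
  -- The order condition is automatic: the first entry of `u.drop m` is `π (Fin.last m)`, so an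
  -- entry smaller than it comes later.
  have hd : ∀ j : Fin (u.drop m).length, (if dropHead u hu < j ∧ (u.drop m).get j < (u.drop m).get (dropHead u hu) then
      intervalLength (u.drop m) c j else 0) = intervalLength (u.drop m) c j * if (u.drop m).get j < π (Fin.last m) then 1 else 0 := by
    intro j
    rw [get_dropHead hπ hu]
    by_cases h : (u.drop m).get j < π (Fin.last m)
    · have : dropHead u hu < j := by
        refine Nat.pos_of_ne_zero fun h0 => ?_
        rw [(dropHead_iff hu j).mp h0, get_dropHead hπ hu] at h
        exact lt_irrefl _ h
      rw [if_pos ⟨this, h⟩, if_pos h, mul_one]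
    · rw [if_neg fun h' => h h'.2, if_neg h, mul_zero]
  have hinv : invCount π = (∑ i : Fin m, ∑ j : Fin m,
      if i.castSucc < j.castSucc ∧ π j.castSucc < π i.castSucc then 1 else 0) +
        ∑ i : Fin m, if π (Fin.last m) < π i.castSucc then 1 else 0 := by
    simp only [invCount]
    rw [Fin.sum_univ_castSucc, ← Finset.sum_add_distrib]
    rw [Finset.sum_eq_zero (s := Finset.univ) (f := fun j => if Fin.last m < j ∧ _ then 1 else 0)
      fun j _ => if_neg fun h => absurd h.1 (not_lt.mpr (Fin.le_last j)), add_zero]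
    refine Finset.sum_congr rfl fun i _ => ?_
    rw [Fin.sum_univ_castSucc]
    simp [Fin.castSucc_lt_last]
  unfold cutSign
  rw [hpos, sum_headIdx_add_sum_dropIdx u hu]
  simp only [sum_headIdx_add_sum_dropIdx u hu, hHH, hHD, hDH, hDD, Finset.sum_add_distrib,
    Finset.sum_const_zero, zero_add]
  rw [hinv]
  -- The extra unit of the first remaining interval against the trivial intervals before it.
  have e1 : ∑ i : Fin m, ∑ j : Fin (u.drop m).length, (if j = dropHead u hu then
      (if (u.drop m).get j < π i.castSucc then 1 else 0) else 0) =
      ∑ i : Fin m, if π (Fin.last m) < π i.castSucc then 1 else 0 := by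
    refine Finset.sum_congr rfl fun i _ => ?_
    rw [Finset.sum_ite_eq', if_pos (Finset.mem_univ _), get_dropHead hπ hu]
  -- The same extra unit against the later intervals.
  have e2 : ∑ i : Fin (u.drop m).length, ∑ j : Fin (u.drop m).length, (if i = dropHead u hu then
      (if i < j ∧ (u.drop m).get j < (u.drop m).get i then intervalLength (u.drop m) c j else 0) else 0) =
      ∑ j : Fin (u.drop m).length, intervalLength (u.drop m) c j * if (u.drop m).get j < π (Fin.last m) then 1 else 0 := by
    rw [Finset.sum_comm]
    refine Finset.sum_congr rfl fun j _ => ?_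
    rw [Finset.sum_ite_eq', if_pos (Finset.mem_univ _), hd]
  have e3 : ∑ j : Fin (u.drop m).length, intervalLength (u.drop m) c j * (m - ((u.drop m).get j : ℕ)) =
      (∑ i : Fin m, ∑ j : Fin (u.drop m).length, intervalLength (u.drop m) c j * if (u.drop m).get j < π i.castSucc then 1 else 0) +
        ∑ j : Fin (u.drop m).length, intervalLength (u.drop m) c j * if (u.drop m).get j < π (Fin.last m) then 1 else 0 := by
    rw [Finset.sum_comm, ← Finset.sum_add_distrib]
    refine Finset.sum_congr rfl fun j _ => ?_
    rw [← sum_lt_eq_sub π, Fin.sum_univ_castSucc, mul_add, Finset.mul_sum]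
  rw [e1, e2, e3]
  ring

end Lift

end EInftySusp

/-! ### The interval cut of `(x, 1)` -/

namespace EInftySusp

variable (R : Type v) [CommRing R]

section Factors

variable {r : ℕ} (u : List (Fin r)) {k : ℕ} (c : Fin (u.length + 1) → Fin (k + 1))

open Classical in
/-- The tensor factor `x(Δ(C_(a)))` of the interval cut coproduct. -/
noncomputable def cutFactor (X : PSSet.{u}) (x : X.sset _⦋k⦌) (a : Fin r) (p : ℤ) :
    Cell X p →₀ R :=
  if CutNondegenerate u c a then faceCls R X x (cutVertices u c a) p else 0

theorem intervalCut_eq (X : PSSet.{u}) (x : X.sset _⦋k⦌) (p : Fin r → ℤ) :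
    intervalCut R u X x p = ∑ c ∈ cuts u.length k, (-1 : R) ^ cutSign u c •
      ⨂ₜ[R] a, cutFactor R u c X x a (p a) := rfl

variable {R u c}

theorem cutFactor_of_nondegenerate {X : PSSet.{u}} {x : X.sset _⦋k⦌} {a : Fin r} {p : ℤ}
    (h : CutNondegenerate u c a) :
    cutFactor R u c X x a p = faceCls R X x (cutVertices u c a) p := if_pos h

theorem cutNondegenerate_of_cutFactor_ne_zero {X : PSSet.{u}} {x : X.sset _⦋k⦌} {a : Fin r}
    {p : ℤ} (h : cutFactor R u c X x a p ≠ 0) : CutNondegenerate u c a := by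
  by_contra h'
  exact h (if_neg h')

open Classical in
-- A nonzero factor has dimension one less than its number of vertices. This turns the degrees in
-- the suspension sign into the lengths in the cut sign.
theorem eq_sum_intervalLength (hc : c ∈ cuts u.length k) {X : PSSet.{u}} {x : X.sset _⦋k⦌}
    {a : Fin r} (ha : a ∈ u) {p : ℤ} (h : cutFactor R u c X x a p ≠ 0) :
    p = ((∑ j : Fin u.length, if u.get j = a then intervalLength u c j else 0 : ℕ) : ℤ) := by
  have hn := cutNondegenerate_of_cutFactor_ne_zero h
  rw [cutFactor_of_nondegenerate hn] at h
  have h1 : ((cutVertices u c a).card : ℤ) = p + 1 := by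
    by_contra h'
    exact h (faceCls_of_ne R X x _ h')
  simp only [cuts, Finset.mem_filter, Finset.mem_univ, true_and] at hc
  rw [card_cutVertices u c hc.1 ha hn, Nat.cast_add_one] at h1
  exact (add_right_cancel h1).symm

theorem tprod_cutFactor_eq_zero {X : PSSet.{u}} {x : X.sset _⦋k⦌} {p : Fin r → ℤ}
    (h : ∃ a, cutFactor R u c X x a (p a) = 0) :
    (⨂ₜ[R] a, cutFactor R u c X x a (p a)) = 0 := by
  obtain ⟨a, ha⟩ := h
  exact MultilinearMap.map_coord_zero _ a ha

variable (R u) in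
open Classical in
/-- The interval cut cooperation of a surjection `u` has degree `|u|`. -/
theorem intervalCut_eq_zero (hs : ∀ a, a ∈ u) (X : PSSet.{u}) (x : X.sset _⦋k⦌) (p : Fin r → ℤ)
    (hp : ∑ a, p a + r ≠ k + u.length) : intervalCut R u X x p = 0 := by
  rw [intervalCut_eq]
  refine Finset.sum_eq_zero fun c hc => ?_
  rw [tprod_cutFactor_eq_zero, smul_zero]
  by_contra! h
  refine hp ?_
  have h1 : ∀ a, p a = _ := fun a => eq_sum_intervalLength hc (hs a) (h a)
  rw [Finset.sum_congr rfl fun a _ => h1 a, ← Nat.cast_sum, Finset.sum_comm]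
  simp only [Finset.sum_ite_eq, Finset.mem_univ, if_true]
  rw [sum_intervalLength u c hc]
  have := sum_isInner u hs
  rw [Nat.cast_add]
  omega

end Factors

section Lift

variable {m : ℕ} {u : List (Fin (m + 1))} {k : ℕ} {π : Equiv.Perm (Fin (m + 1))}

/-- Lifting adds only the vertex `0` to `C_(a)`, and does not repeat it: of two equal entries, the
later one lies beyond the initial permutation, so its interval starts at a positive vertex. -/
theorem cutNondegenerate_liftCut (hπ : List.ofFn π = u.take (m + 1))
    (c : Fin ((u.drop m).length + 1) → Fin (k + 1)) (a : Fin (m + 1)) :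
    CutNondegenerate u (liftCut u c) a ↔ CutNondegenerate (u.drop m) c a := by
  constructor
  · intro h i j hij hi hj
    have h1 := h (dropIdx u i) (dropIdx u j) ((dropIdx_lt_iff u i j).mpr hij)
      (by rw [get_dropIdx, hi]) (by rw [get_dropIdx, hj])
    have hij' : (i : ℕ) < j := hij
    rw [liftCut_dropIdx_succ, liftCut_dropIdx_castSucc u c j (by omega)] at h1
    exact Fin.succ_lt_succ_iff.mp h1
  · intro h i j hij hi hj
    have hij' : (i : ℕ) < j := hij
    have hmj : m < (j : ℕ) := by
      by_contra hcon
      rw [get_of_ofFn_eq_take hπ i (by omega)] at hi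
      rw [get_of_ofFn_eq_take hπ j (by omega)] at hj
      have := Fin.ext_iff.mp (π.injective (hi.trans hj.symm))
      simp only at this
      omega
    rcases lt_or_eq_dropIdx u j with h' | ⟨j, rfl⟩
    · omega
    have hj0 : (j : ℕ) ≠ 0 := by simp only [dropIdx] at hmj; omega
    rw [liftCut_dropIdx_castSucc u c j hj0]
    rcases lt_or_eq_dropIdx u i with h' | ⟨i, rfl⟩
    · rw [liftCut_succ_of_lt u c i h']
      exact Fin.succ_pos _
    · rw [liftCut_dropIdx_succ, Fin.succ_lt_succ_iff]
      exact h i j ((dropIdx_lt_iff u i j).mp hij) (by rw [← get_dropIdx, hi])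
        (by rw [← get_dropIdx, hj])

theorem zero_mem_cutVertices_liftCut (hπ : List.ofFn π = u.take (m + 1))
    (c : Fin ((u.drop m).length + 1) → Fin (k + 1)) (a : Fin (m + 1)) :
    0 ∈ cutVertices u (liftCut u c) a := by
  have hu := length_of_ofFn_eq_take hπ
  simp only [cutVertices, Finset.mem_biUnion, Finset.mem_filter, Finset.mem_univ, true_and,
    Finset.mem_Icc]
  refine ⟨⟨π.symm a, by omega⟩, ?_, ?_, Fin.zero_le _⟩
  · rw [get_of_ofFn_eq_take hπ _ (π.symm a).isLt]
    exact π.apply_symm_apply a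
  · rw [liftCut_of_le u c (by simp only [Fin.val_castSucc]; omega)]

theorem tailSet_cutVertices_liftCut (c : Fin ((u.drop m).length + 1) → Fin (k + 1))
    (hc : c 0 = 0) (a : Fin (m + 1)) :
    tailSet (cutVertices u (liftCut u c) a) = cutVertices (u.drop m) c a := by
  ext b
  simp only [mem_tailSet, cutVertices, Finset.mem_biUnion, Finset.mem_filter, Finset.mem_univ,
    true_and, Finset.mem_Icc]
  constructor
  · rintro ⟨i, hi, h1, h2⟩
    rcases lt_or_eq_dropIdx u i with h' | ⟨i, rfl⟩
    · rw [liftCut_succ_of_lt u c i h'] at h2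
      exact absurd h2 (not_le.mpr (Fin.succ_pos b))
    · refine ⟨i, by rw [← get_dropIdx, hi], ?_, ?_⟩
      · by_cases h0 : (i : ℕ) = 0
        · have : i.castSucc = 0 := Fin.ext h0
          rw [this, hc]
          exact Fin.zero_le _
        · rw [liftCut_dropIdx_castSucc u c i h0] at h1
          exact Fin.succ_le_succ_iff.mp h1
      · rw [liftCut_dropIdx_succ] at h2
        exact Fin.succ_le_succ_iff.mp h2
  · rintro ⟨i, hi, h1, h2⟩
    refine ⟨dropIdx u i, by rw [get_dropIdx, hi], ?_, ?_⟩
    · by_cases h0 : (i : ℕ) = 0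
      · rw [liftCut_dropIdx_castSucc_zero u c i h0]
        exact Fin.zero_le _
      · rw [liftCut_dropIdx_castSucc u c i h0]
        exact Fin.succ_le_succ_iff.mpr h1
    · rw [liftCut_dropIdx_succ]
      exact Fin.succ_le_succ_iff.mpr h2

theorem cutFactor_liftCut (hπ : List.ofFn π = u.take (m + 1))
    (c : Fin ((u.drop m).length + 1) → Fin (k + 1)) (hc : c 0 = 0) (X : PSSet.{u})
    (h : 1 + k = k + 1) (x : X.sset _⦋k⦌) (a : Fin (m + 1)) {p q : ℤ} (hpq : p + 1 = q) :
    cutFactor R u (liftCut u c) X.susp (X.cone h x) a q =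
      suspLinEquiv R X hpq (cutFactor R (u.drop m) c X x a p) := by
  by_cases hn : CutNondegenerate (u.drop m) c a
  · rw [cutFactor_of_nondegenerate hn,
      cutFactor_of_nondegenerate ((cutNondegenerate_liftCut hπ c a).mpr hn),
      faceCls_cone R X h x _ (zero_mem_cutVertices_liftCut hπ c a) hpq,
      tailSet_cutVertices_liftCut c hc]
  · rw [cutFactor, cutFactor, if_neg hn, if_neg ((cutNondegenerate_liftCut hπ c a).not.mpr hn),
      map_zero]

/-- A factor without the cone point is a face in the collapsed copy of `X`, so in a nonzero term
every `C_(a)` contains `0`. -/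
theorem exists_liftCut_of_cutFactor_ne_zero (c : Fin (u.length + 1) → Fin (k + 2))
    (hc : c ∈ cuts u.length (k + 1)) (X : PSSet.{u}) (h : 1 + k = k + 1) (x : X.sset _⦋k⦌)
    (p : Fin (m + 1) → ℤ) (hne : ∀ a, cutFactor R u c X.susp (X.cone h x) a (p a) ≠ 0) :
    (∃ π : Equiv.Perm (Fin (m + 1)), List.ofFn π = u.take (m + 1)) ∧
      (∀ a, a ∈ u.drop m) ∧ ∃ c' ∈ cuts (u.drop m).length k, liftCut u c' = c := by
  have hn := fun a => cutNondegenerate_of_cutFactor_ne_zero (hne a)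
  have h0 : ∀ a, 0 ∈ cutVertices u c a := by
    intro a
    by_contra h0
    refine hne a ?_
    rw [cutFactor_of_nondegenerate (hn a), faceCls_cone_of_notMem R X h x _ h0]
  obtain ⟨⟨π, hπ⟩, hz⟩ := take_eq_ofFn_of_zero_mem u c hc fun a => ⟨hn a, h0 a⟩
  obtain ⟨c', hc', rfl⟩ := exists_liftCut_eq u c hc hz
  have hc0 : c' 0 = 0 := by
    simp only [cuts, Finset.mem_filter, Finset.mem_univ, true_and] at hc'
    exact hc'.2.1
  refine ⟨⟨π, hπ⟩, fun a => ?_, c', hc', rfl⟩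
  by_contra ha
  refine hne a ?_
  rw [cutFactor_liftCut R hπ c' hc0 X h x a (sub_add_cancel (p a) 1),
    cutFactor_of_nondegenerate ((cutNondegenerate_liftCut hπ c' a).mp (hn a))]
  -- If `a` does not occur in `u.drop m`, its factor is the cone point alone, whose class is `0`.
  have : cutVertices (u.drop m) c' a = ∅ := by
    rw [Finset.eq_empty_iff_forall_notMem]
    intro b hb
    simp only [cutVertices, Finset.mem_biUnion, Finset.mem_filter, Finset.mem_univ,
      true_and] at hb
    obtain ⟨i, hi, -⟩ := hb
    exact ha (hi ▸ List.get_mem _ i)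
  rw [this, faceCls_empty, map_zero]

theorem intervalCut_cone_eq_zero (X : PSSet.{u}) (h : 1 + k = k + 1) (x : X.sset _⦋k⦌)
    (p : Fin (m + 1) → ℤ)
    (hu : ¬((∃ π : Equiv.Perm (Fin (m + 1)), List.ofFn π = u.take (m + 1)) ∧
      ∀ a, a ∈ u.drop m)) :
    intervalCut R u X.susp (X.cone h x) p = 0 := by
  rw [intervalCut_eq]
  refine Finset.sum_eq_zero fun c hc => ?_
  rw [tprod_cutFactor_eq_zero, smul_zero]
  by_contra! hne
  have := exists_liftCut_of_cutFactor_ne_zero R c hc X h x p hne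
  exact hu ⟨this.1, this.2.1⟩

open Classical in
-- The surviving cuts are lifts, so the sums match term by term. In the sign, the length of `u.drop
-- m` minus `r` is its number of inner intervals.
theorem intervalCut_cone (X : PSSet.{u}) (h : 1 + k = k + 1) (x : X.sset _⦋k⦌)
    (p q : Fin (m + 1) → ℤ) (hpq : ∀ a, p a + 1 = q a) (hπ : List.ofFn π = u.take (m + 1))
    (hs : ∀ a, a ∈ u.drop m) :
    intervalCut R u X.susp (X.cone h x) q =
      (((Equiv.Perm.sign π : ℤ) : R) *
        ksign R (((u.drop m).length : ℤ) - (m + 1) + ∑ a : Fin (m + 1), p a * (m - (a : ℕ)))) •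
      PiTensorProduct.map (fun a => (suspLinEquiv R X (hpq a)).toLinearMap)
        (intervalCut R (u.drop m) X x p) := by
  have hu := length_of_ofFn_eq_take hπ
  rw [intervalCut_eq, intervalCut_eq, map_sum, Finset.smul_sum]
  symm
  refine Finset.sum_of_injOn (liftCut u) (liftCut_injOn u)
    (fun c hc => liftCut_mem_cuts u c hu hc) ?_ ?_
  · intro c hc hc'
    rw [tprod_cutFactor_eq_zero, smul_zero]
    by_contra! hne
    exact hc' (exists_liftCut_of_cutFactor_ne_zero R c hc X h x q hne).2.2
  · intro c hc
    have hc0 : c 0 = 0 := by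
      simp only [cuts, Finset.mem_filter, Finset.mem_univ, true_and] at hc
      exact hc.2.1
    simp only [cutFactor_liftCut R hπ c hc0 X h x _ (hpq _), map_smul, PiTensorProduct.map_tprod,
      LinearEquiv.coe_coe]
    -- The degrees `p a` are tied to the cut only if no factor vanishes; otherwise both terms are
    -- `0`.
    by_cases hne : ∃ a, cutFactor R (u.drop m) c X x a (p a) = 0
    · obtain ⟨a, ha⟩ := hne
      rw [MultilinearMap.map_coord_zero _ a (by rw [ha, map_zero])]
      simp
    · push Not at hne
      rw [smul_smul]
      congr 1
      have hp : ∀ a, p a = _ := fun a => eq_sum_intervalLength hc (hs a) (hne a)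
      have h1 : ∑ a : Fin (m + 1), p a * (m - (a : ℕ)) =
          ((∑ j, intervalLength (u.drop m) c j * (m - ((u.drop m).get j : ℕ)) : ℕ) : ℤ) := by
        push_cast
        calc _ = ∑ a : Fin (m + 1), ∑ j : Fin (u.drop m).length,
              if (u.drop m).get j = a then
                (intervalLength (u.drop m) c j : ℤ) * (m - (a : ℕ)) else 0 := by
              refine Finset.sum_congr rfl fun a _ => ?_
              rw [hp a, Nat.cast_sum, Finset.sum_mul]
              refine Finset.sum_congr rfl fun j _ => ?_
              split_ifs <;> simp
          _ = _ := by
              rw [Finset.sum_comm]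
              refine Finset.sum_congr rfl fun j _ => ?_
              rw [Finset.sum_ite_eq, if_pos (Finset.mem_univ _), Nat.cast_sub]
              have := ((u.drop m).get j).isLt
              omega
      have h2 : ((u.drop m).length : ℤ) - (m + 1) =
          ((∑ j : Fin (u.drop m).length, if IsInner (u.drop m) j then 1 else 0 : ℕ) : ℤ) := by
        have := sum_isInner (u.drop m) hs
        omega
      rw [h1, h2, ← Nat.cast_add, ksign_natCast, cutSign_liftCut c hπ hs hc0,
        ← neg_one_pow_invCount, ← pow_add, ← pow_add]
      congr 1
      ring

end Lift

end EInftySusp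

/-! ### Compatibility with the surjection operad -/

namespace EInftySusp

variable (R : Type v) [CommRing R]

theorem surjCls_eq_single {r : ℕ} {d : ℤ} {l : List (Fin r)} (h0 : 0 < r) (h1 : ∀ k, k ∈ l)
    (h2 : l.IsChain (· ≠ ·)) (h3 : (l.length : ℤ) = r + d) :
    surjCls R d l = Finsupp.single ⟨l, h0, h1, h2, h3⟩ 1 :=
  dif_pos ⟨h0, h1, h2, h3⟩

theorem surjCls_eq_zero_of_notMem {r : ℕ} {d : ℤ} {l : List (Fin r)} {k : Fin r} (hk : k ∉ l) :
    surjCls R d l = 0 :=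
  dif_neg fun h => hk (h.2.1 k)

theorem sigmaSurj_single (r : ℕ) (d : ℤ) (u : SurjSeq r d) :
    sigmaSurj R r d (Finsupp.single u 1) =
      (sgn (u.seq.take r) : R) • surjCls R (d - r + 1) (u.seq.drop (r - 1)) := by
  rw [sigmaSurj, Finsupp.linearCombination_single, one_smul]

/-- The formula for `σ` persists for sequences representing `0`, which is needed because the terms
of a table reduction may be degenerate. The reason is that a sequence is surjective and
non-degenerate as soon as it begins with a permutation and its part from the `r`-th entry on is so.
-/
theorem sigmaSurj_surjCls (r : ℕ) (d : ℤ) (l : List (Fin r)) :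
    sigmaSurj R r d (surjCls R d l) =
      (sgn (l.take r) : R) • surjCls R (d - r + 1) (l.drop (r - 1)) := by
  by_cases h : 0 < r ∧ (∀ k, k ∈ l) ∧ l.IsChain (· ≠ ·) ∧ (l.length : ℤ) = r + d
  · rw [surjCls_eq_single R h.1 h.2.1 h.2.2.1 h.2.2.2, sigmaSurj_single]
  · have h0 : surjCls R d l = 0 := dif_neg h
    rw [h0, map_zero]
    symm
    by_cases hπ : ∃ π : Equiv.Perm (Fin r), List.ofFn π = l.take r
    · obtain ⟨π, hπ⟩ := hπ
      have h1 : surjCls R (d - r + 1) (l.drop (r - 1)) = 0 := by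
        refine dif_neg fun h' => h ⟨h'.1, fun k => List.mem_of_mem_drop (h'.2.1 k), ?_, ?_⟩
        · obtain ⟨m, rfl⟩ : ∃ m, r = m + 1 := ⟨r - 1, by omega⟩
          rw [List.isChain_iff_getElem]
          intro i hi
          -- Adjacent entries either both lie in the initial permutation or both lie in the
          -- remaining sequence, since the two overlap in the entry at `m`.
          rcases Nat.lt_or_ge i m with him | him
          · have e1 := get_of_ofFn_eq_take hπ ⟨i, by omega⟩ (by simp only; omega)
            have e2 := get_of_ofFn_eq_take hπ ⟨i + 1, by omega⟩ (by simp only; omega)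
            rw [List.get_eq_getElem] at e1 e2
            simp only at e1 e2
            rw [e1, e2, Ne, π.injective.eq_iff, Fin.mk.injEq]
            omega
          · have := List.isChain_iff_getElem.mp h'.2.2.1 (i - m) (by
              rw [List.length_drop]; omega)
            simp only [List.getElem_drop] at this
            convert this using 2 <;> omega
        · have h2 := congrArg List.length hπ
          rw [List.length_ofFn, List.length_take] at h2
          have h3 := h'.2.2.2
          rw [List.length_drop] at h3
          have := h'.1
          omega
      rw [h1, smul_zero]
    · rw [sgn_eq_zero hπ, Int.cast_zero, zero_smul]

/-- The interval cut cooperations, on the free modules on the cells. -/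
noncomputable def cellCoops (X : PSSet.{u}) (r : ℕ) (d : ℤ) : SurjOp R r d →ₗ[R]
    ∀ (n : ℤ) (p : Fin r → ℤ), (Cell X n →₀ R) →ₗ[R] ⨂[R] i, (Cell X (p i) →₀ R) :=
  Finsupp.linearCombination R fun u : SurjSeq r d => fun n p =>
    Finsupp.linearCombination R fun s : Cell X n => intervalCut R u.seq X s.x p

theorem cellCoops_single {X : PSSet.{u}} {r : ℕ} {d : ℤ} (u : SurjSeq r d) (n : ℤ)
    (p : Fin r → ℤ) (s : Cell X n) :
    cellCoops R X r d (Finsupp.single u 1) n p (Finsupp.single s 1) =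
      intervalCut R u.seq X s.x p := by
  rw [cellCoops, Finsupp.linearCombination_single, one_smul, Finsupp.linearCombination_single,
    one_smul]

/-- The tensor power of the isomorphism `x ↦ (x, 1)`. -/
noncomputable def suspTensor (X : PSSet.{u}) {r : ℕ} {p q : Fin r → ℤ} (hpq : ∀ i, p i + 1 = q i) :
    (⨂[R] i, (Cell X (p i) →₀ R)) →ₗ[R] ⨂[R] i, (Cell X.susp (q i) →₀ R) :=
  PiTensorProduct.map fun i => (suspLinEquiv R X (hpq i)).toLinearMap

/-- The two ways in which no cut survives are the two ways in which `σ(u)` vanishes: the sign is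
`0`, or the remaining sequence misses a value. -/
theorem intervalCut_cone_eq_suspTensor (X : PSSet.{u}) {r : ℕ} {d : ℤ} (u : SurjSeq r d) {m : ℤ}
    {p q : Fin r → ℤ} (hpq : ∀ i, p i + 1 = q i) (s : Cell X m) {K : ℕ} (hK : 1 + s.dim = K) :
    intervalCut R u.seq X.susp (X.cone hK s.x) q =
      suspTensor R X hpq (ksign R ((d - r + 1) + ∑ i : Fin r, p i * ((r : ℤ) - 1 - (i : ℕ))) •
        cellCoops R X r (d - r + 1) (sigmaSurj R r d (Finsupp.single u 1)) m p
          (Finsupp.single s 1)) := by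
  rw [sigmaSurj_single]
  obtain ⟨l, h0, h1, h2, h3⟩ := u
  obtain ⟨t, rfl⟩ : ∃ t, r = t + 1 := ⟨r - 1, by omega⟩
  obtain rfl : K = s.dim + 1 := by omega
  simp only [Nat.add_sub_cancel, map_smul, Pi.smul_apply, LinearMap.smul_apply]
  by_cases hπ : ∃ π : Equiv.Perm (Fin (t + 1)), List.ofFn π = l.take (t + 1)
  · by_cases hs : ∀ a, a ∈ l.drop t
    · obtain ⟨π, hπ⟩ := hπ
      have hl : ((l.drop t).length : ℤ) = (t + 1 : ℕ) + (d - (t + 1 : ℕ) + 1) := by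
        have := length_of_ofFn_eq_take hπ
        rw [List.length_drop]
        omega
      rw [surjCls_eq_single R h0 hs (h2.drop t) hl, cellCoops_single,
        intervalCut_cone R X hK s.x p q hpq hπ hs, hl, ← hπ, sgn_ofFn, mul_comm, mul_smul]
      congr 2
      push_cast
      congr 1
      · ring
      · exact Finset.sum_congr rfl fun i _ => by ring
    · rw [intervalCut_cone_eq_zero R X hK s.x q fun h => hs h.2]
      push Not at hs
      obtain ⟨a, ha⟩ := hs
      rw [surjCls_eq_zero_of_notMem R ha]
      simp
  · rw [intervalCut_cone_eq_zero R X hK s.x q fun h => hπ h.1, sgn_eq_zero hπ]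
    simp

/-- The isomorphism `x ↦ (x, 1)` is compatible with the cooperations of the surjection operad. -/
theorem cellCoops_suspLinEquiv (X : PSSet.{u}) {r : ℕ} {d : ℤ} (a : SurjOp R r d) {m n : ℤ}
    (h : m + 1 = n) {p q : Fin r → ℤ} (hpq : ∀ i, p i + 1 = q i) (z : Cell X m →₀ R) :
    cellCoops R X.susp r d a n q (suspLinEquiv R X h z) =
      suspTensor R X hpq (ksign R ((d - r + 1) + ∑ i : Fin r, p i * ((r : ℤ) - 1 - (i : ℕ))) •
        cellCoops R X r (d - r + 1) (sigmaSurj R r d a) m p z) := by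
  induction a using Finsupp.induction_linear with
  | zero => simp
  | add a b ha hb =>
    simp only [map_add, Pi.add_apply, LinearMap.add_apply, ha, hb, smul_add]
  | single u b =>
    rw [← mul_one b, ← smul_eq_mul, ← Finsupp.smul_single]
    simp only [map_smul, Pi.smul_apply, LinearMap.smul_apply]
    rw [smul_comm (ksign R _) b]
    congr 1
    induction z using Finsupp.induction_linear with
    | zero => simp
    | add y z hy hz => simp only [map_add, hy, hz, smul_add]
    | single s b =>
      rw [← mul_one b, ← smul_eq_mul, ← Finsupp.smul_single]
      simp only [map_smul]
      rw [smul_comm (ksign R _) b]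
      congr 1
      rw [suspLinEquiv_single, cellCoops_single]
      exact (intervalCut_cone_eq_suspTensor R X u hpq s rfl).trans (map_smul _ _ _)

/-- The cooperation of an element of degree `d` has degree `d`. -/
theorem cellCoops_eq_zero (X : PSSet.{u}) {r : ℕ} {d : ℤ} (a : SurjOp R r d) {n : ℤ}
    {p : Fin r → ℤ} (hp : ∑ i, p i ≠ n + d) (z : Cell X n →₀ R) :
    cellCoops R X r d a n p z = 0 := by
  induction a using Finsupp.induction_linear with
  | zero => simp
  | add a b ha hb => rw [map_add, Pi.add_apply, Pi.add_apply, LinearMap.add_apply, ha, hb, add_zero]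
  | single u b =>
    rw [← mul_one b, ← smul_eq_mul, ← Finsupp.smul_single, map_smul, Pi.smul_apply, Pi.smul_apply,
      LinearMap.smul_apply]
    induction z using Finsupp.induction_linear with
    | zero => simp
    | add y z hy hz => rw [map_add, smul_add, hy, hz, add_zero]
    | single s b =>
      rw [← mul_one b, ← smul_eq_mul, ← Finsupp.smul_single, map_smul, cellCoops_single,
        intervalCut_eq_zero R u.seq u.surj, smul_zero, smul_zero]
      have h1 := u.length_eq
      have h2 := s.dim_eq
      omega

end EInftySusp

namespace EInftySusp

/-! ### Compatibility of the table reduction with the suspension morphisms -/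

section Table

/-- Each row omits the used values, and the list of used values only grows. -/
theorem notMem_tableRows {r : ℕ} (w : List (Equiv.Perm (Fin r))) (a : List ℕ)
    (used : List (Fin r)) {k : Fin r} (hk : k ∈ used) : k ∉ tableRows w a used := by
  induction w generalizing a used with
  | nil => simp [tableRows]
  | cons π w ih =>
    cases a with
    | nil => simp [tableRows]
    | cons b a =>
      simp only [tableRows, List.mem_append, not_or]
      refine ⟨fun h => ?_, ih a _ (List.mem_append_left _ hk)⟩
      have := List.mem_of_mem_take h
      simp only [List.mem_filter, decide_eq_true_eq] at this
      exact this.2 hk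

variable {s : ℕ}

theorem tableRows_cons_nil (π : Equiv.Perm (Fin (s + 1))) (w : List (Equiv.Perm (Fin (s + 1))))
    (b : ℕ) (a : List ℕ) :
    tableRows (π :: w) (b :: a) [] =
      (List.ofFn π).take b ++ tableRows w a ((List.ofFn π).take b).dropLast := by
  have : (List.ofFn π).filter (fun k => k ∉ ([] : List (Fin (s + 1)))) = List.ofFn π :=
    List.filter_eq_self.mpr (by simp)
  simp only [tableRows, this, List.nil_append]

/-- The only entry of a row of length one is its last, so the row adds nothing to the used values.
-/
theorem tableRows_one_cons (π : Equiv.Perm (Fin (s + 1))) (w : List (Equiv.Perm (Fin (s + 1))))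
    (a : List ℕ) : tableRows (π :: w) (1 :: a) [] = π 0 :: tableRows w a [] := by
  rw [tableRows_cons_nil, List.ofFn_succ]
  simp

theorem tableRows_replicate_append (t : ℕ) (w : List (Equiv.Perm (Fin (s + 1)))) (a : List ℕ)
    (ht : t ≤ w.length) :
    tableRows w (List.replicate t 1 ++ a) [] =
      (w.take t).map (fun π => π 0) ++ tableRows (w.drop t) a [] := by
  induction t generalizing w with
  | zero => simp
  | succ t ih =>
    cases w with
    | nil => simp at ht
    | cons π w =>
      rw [List.replicate_succ, List.cons_append, tableRows_one_cons,
        ih w (by simpa using ht)]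
      simp

theorem take_one_tableRows (w : List (Equiv.Perm (Fin (s + 1)))) (a : List ℕ)
    (hw : w.length = a.length) (ha : ∀ b ∈ a, 1 ≤ b) :
    (tableRows w a []).take 1 = (w.take 1).map fun π => π 0 := by
  cases w with
  | nil => simp [tableRows]
  | cons π w =>
    cases a with
    | nil => simp at hw
    | cons b a =>
      obtain ⟨b, rfl⟩ : ∃ b', b = b' + 1 :=
        ⟨b - 1, by have := ha b List.mem_cons_self; omega⟩
      rw [tableRows_cons_nil, List.ofFn_succ]
      simp

/-- Take the first row of length other than one. Only rows of length one precede it, so its first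
entry stands among the `t` dropped ones; that entry is used up by its row and does not occur again.
-/
theorem exists_notMem_drop_tableRows (t : ℕ) (w : List (Equiv.Perm (Fin (s + 1)))) (a : List ℕ)
    (hw : w.length = a.length) (ha : ∀ b ∈ a, 1 ≤ b) (ht : t < s + 1)
    (h : ¬∀ b ∈ a.take t, b = 1) : ∃ k, k ∉ (tableRows w a []).drop t := by
  induction t generalizing w a with
  | zero => simp at h
  | succ t ih =>
    cases a with
    | nil => simp at h
    | cons b a =>
      cases w with
      | nil => simp at hw
      | cons π w =>
        by_cases hb : b = 1
        · subst hb
          rw [tableRows_one_cons, List.drop_succ_cons]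
          refine ih w a (by simpa using hw) (fun b hb => ha b (List.mem_cons_of_mem _ hb))
            (by omega) fun h' => h ?_
          simpa using h'
        · obtain ⟨c, rfl⟩ : ∃ c, b = c + 2 :=
            ⟨b - 2, by have := ha b List.mem_cons_self; omega⟩
          -- By `ht` there are at least two values, so the row really has a second entry and `π 0`
          -- is not its last.
          obtain ⟨s, rfl⟩ : ∃ s', s = s' + 1 := ⟨s - 1, by omega⟩
          refine ⟨π 0, ?_⟩
          rw [tableRows_cons_nil, List.ofFn_succ, List.take_succ_cons, List.cons_append,
            List.drop_succ_cons]
          intro hmem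
          rcases List.mem_append.mp (List.mem_of_mem_drop hmem) with h1 | h1
          · have := List.mem_of_mem_take h1
            rw [List.mem_ofFn] at this
            obtain ⟨i, hi⟩ := this
            exact Fin.succ_ne_zero i (π.injective hi)
          · refine notMem_tableRows w a _ ?_ h1
            rw [List.ofFn_succ, List.take_succ_cons, List.dropLast_cons_cons]
            exact List.mem_cons_self

end Table

variable (R : Type v) [CommRing R]

theorem permCls_eq_single {r : ℕ} {d : ℤ} {l : List (Equiv.Perm (Fin r))} (h0 : 0 < r)
    (h1 : l ≠ []) (h2 : l.IsChain (· ≠ ·)) (h3 : (l.length : ℤ) = d + 1) :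
    permCls R d l = Finsupp.single ⟨l, h0, h1, h2, h3⟩ 1 :=
  dif_pos ⟨h0, h1, h2, h3⟩

theorem surjCls_drop_tableRows_eq_zero {t : ℕ} {d : ℤ} (w : List (Equiv.Perm (Fin (t + 1))))
    (a : List ℕ) (hw : w.length = a.length) (ha : ∀ b ∈ a, 1 ≤ b)
    (h : ¬∀ b ∈ a.take t, b = 1) :
    surjCls R d ((tableRows w a []).drop t) = 0 := by
  obtain ⟨k, hk⟩ := exists_notMem_drop_tableRows t w a hw ha (by omega) h
  exact surjCls_eq_zero_of_notMem R hk

/-- The composition `(1, …, 1, a_1, …, a_l)`. -/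
def onesAppend (t : ℕ) {n n' : ℕ} (h : t + n = n') (a : Composition n) : Composition n' where
  blocks := List.replicate t 1 ++ a.blocks
  blocks_pos := by
    intro i hi
    rcases List.mem_append.mp hi with h | h
    · rw [List.eq_of_mem_replicate h]
      exact Nat.one_pos
    · exact a.blocks_pos h
  blocks_sum := by simp [a.blocks_sum, h]

/-- Only tables whose first `r - 1` rows have length one survive `σ`. Removing these rows leaves the
tables of `(w_{r-1}, …, w_d)`, and the first `r` entries are `w_0(1), …, w_{r-1}(1)`. -/
theorem tableReduction_sigmaBE_single (r : ℕ) (d : ℤ) (w : PermSeq r d) :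
    sigmaSurj R r d (tableReduction R r d (Finsupp.single w 1)) =
      tableReduction R r (d - r + 1) (sigmaBE R r d (Finsupp.single w 1)) := by
  obtain ⟨w, h0, h1, h2, h3⟩ := w
  obtain ⟨t, rfl⟩ : ∃ t, r = t + 1 := ⟨r - 1, by omega⟩
  have hpos := List.length_pos_iff.mpr h1
  simp only [tableReduction, sigmaBE, Finsupp.linearCombination_single, one_smul, map_sum,
    apply_ite (sigmaSurj R (t + 1) d), map_zero, sigmaSurj_surjCls, map_smul, Nat.add_sub_cancel]
  by_cases hlen : w.length ≤ t
  · rw [sgn_eq_zero (l := (w.take (t + 1)).map _), Int.cast_zero, zero_smul]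
    · refine Finset.sum_eq_zero fun a _ => ?_
      split_ifs with ha
      · rw [surjCls_drop_tableRows_eq_zero R w a.blocks ha.symm
          (fun b hb => a.one_le_blocks hb), smul_zero]
        intro h
        -- With at most `r - 1` rows, all of length one, the row lengths would add up to the number
        -- of rows, which is less than `r + d`.
        rw [List.take_of_length_le (by rw [a.blocks_length, ha]; exact hlen)] at h
        have := a.blocks_sum
        rw [List.eq_replicate_of_mem h, List.sum_replicate, smul_eq_mul, mul_one, a.blocks_length,
          ha] at this
        change w.length = t + 1 + w.length - 1 at this
        omega
      · rfl
    · rintro ⟨π, hπ⟩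
      have := congrArg List.length hπ
      simp at this
      omega
  · have hl : (((w.drop t).length : ℕ) : ℤ) = d - (t + 1 : ℕ) + 1 + 1 := by
      rw [List.length_drop]; omega
    have hdl : (w.drop t).length = w.length - t := List.length_drop
    have hne : w.drop t ≠ [] := by
      rw [Ne, List.drop_eq_nil_iff]; omega
    rw [permCls_eq_single R h0 hne (h2.drop t) hl, Finsupp.linearCombination_single, one_smul,
      Finset.smul_sum]
    symm
    have hn : t + (t + 1 + (w.drop t).length - 1) = t + 1 + w.length - 1 := by
      rw [List.length_drop]; omega
    refine Finset.sum_of_injOn (onesAppend t hn) ?_ (fun _ _ => Finset.mem_coe.mpr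
      (Finset.mem_univ _)) ?_ ?_
    · intro a _ b _ hab
      have := congrArg Composition.blocks hab
      exact Composition.ext (List.append_cancel_left this)
    · intro a _ ha
      split_ifs with hal
      · rw [surjCls_drop_tableRows_eq_zero R w a.blocks hal.symm
          (fun b hb => a.one_le_blocks hb), smul_zero]
        intro h
        refine ha ⟨⟨a.blocks.drop t, fun hi => a.blocks_pos (List.mem_of_mem_drop hi), ?_⟩,
          Finset.mem_coe.mpr (Finset.mem_univ _), ?_⟩
        · have h4 := a.blocks_sum
          rw [← List.take_append_drop t a.blocks, List.sum_append, List.eq_replicate_of_mem h] at h4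
          simp only [List.length_take, List.sum_replicate, smul_eq_mul, mul_one,
            a.blocks_length, hal] at h4
          change _ = t + 1 + (w.drop t).length - 1
          omega
        · refine Composition.ext ?_
          change List.replicate t 1 ++ a.blocks.drop t = a.blocks
          conv_rhs => rw [← List.take_append_drop t a.blocks, List.eq_replicate_of_mem h]
          rw [List.length_take, a.blocks_length, hal, min_eq_left (by omega)]
      · rfl
    · intro a _
      have hal : (onesAppend t hn a).length = t + a.length := by
        simp [onesAppend, Composition.length]
      have hif : (onesAppend t hn a).length = w.length ↔ a.length = (w.drop t).length := by
        rw [hal]; omega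
      by_cases ha : a.length = (w.drop t).length
      · rw [if_pos ha, if_pos (hif.mpr ha)]
        have hrow : tableRows w (onesAppend t hn a).blocks [] =
            (w.take t).map (fun π => π 0) ++ tableRows (w.drop t) a.blocks [] :=
          tableRows_replicate_append t w a.blocks (by omega)
        have htl : ((w.take t).map (fun π => π 0)).length = t := by
          rw [List.length_map, List.length_take]; omega
        -- The `r`-th entry is the first entry of the row of `w_{r-1}`, whatever the length of that
        -- row.
        have h5 : (tableRows w (onesAppend t hn a).blocks []).take (t + 1) =
            (w.take (t + 1)).map fun π => π 0 := by
          rw [hrow, List.take_append, htl, Nat.add_sub_cancel_left,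
            List.take_of_length_le (by omega), take_one_tableRows _ _ ha.symm
              (fun b hb => a.one_le_blocks hb), ← List.map_append, List.take_add]
        have h6 : (tableRows w (onesAppend t hn a).blocks []).drop t =
            tableRows (w.drop t) a.blocks [] := by
          rw [hrow, List.drop_append_of_le_length (by omega), List.drop_of_length_le (by omega),
            List.nil_append]
        rw [h5, h6]
        rfl
      · rw [if_neg ha, if_neg (hif.not.mpr ha), smul_zero]

theorem sigmaSurj_tableReduction (r : ℕ) (d : ℤ) (w : BarrattEccles R r d) :
    sigmaSurj R r d (tableReduction R r d w) =
      tableReduction R r (d - r + 1) (sigmaBE R r d w) := by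
  induction w using Finsupp.induction_linear with
  | zero => simp
  | add a b ha hb => simp only [map_add, ha, hb]
  | single w b =>
    rw [← mul_one b, ← smul_eq_mul, ← Finsupp.smul_single]
    simp only [map_smul, tableReduction_sigmaBE_single]

end EInftySusp

/-! ### The chain and cochain isomorphisms, and dualization -/

namespace EInftySusp

section

variable {R : Type v} [CommRing R]

/-- The isomorphism `s Ñ_*(X) ≅ Ñ_*(ΣX)`, `s x ↦ (x, 1)`. -/
noncomputable def chainsSuspIso (R : Type v) [CommRing R] (X : PSSet.{u}) :
    suspC (chains R X) ≅ chains R X.susp :=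
  HomologicalComplex.Hom.isoOfComponents
    (fun n => (suspLinEquiv R X (sub_add_cancel n 1)).toModuleIso)
    (fun i j _ => by
      refine ModuleCat.hom_ext (LinearMap.ext fun (z : Cell X (i - 1) →₀ R) => ?_)
      change chainsD R X.susp i j (suspLinEquiv R X _ z) =
        suspLinEquiv R X _ (-chainsD R X (i - 1) (j - 1) z)
      rw [suspLinEquiv_chainsD R X _ (sub_add_cancel j 1), map_neg])

/-- The dual of the isomorphism `x ↦ (x, 1)`, with the sign `(-1)^n` in degree `n`. -/
noncomputable def suspDualEquiv (R : Type v) [CommRing R] (X : PSSet.{u}) (n : ℤ) :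
    Module.Dual R (Cell X (-(n + 1)) →₀ R) ≃ₗ[R] Module.Dual R (Cell X.susp (-n) →₀ R) :=
  LinearEquiv.ofLinearMap
    -- An element `s⁻¹ α` of degree `n` has `|α| = n + 1`; this is the sign `(-1)^{|α|}`.
    (ksign R (n + 1) • (suspLinEquiv R X (by omega : -(n + 1) + 1 = -n)).symm.toLinearMap.dualMap)
    (ksign R (n + 1) • (suspLinEquiv R X (by omega : -(n + 1) + 1 = -n)).toLinearMap.dualMap)
    (by
      refine LinearMap.ext fun α => LinearMap.ext fun z => ?_
      simp [← mul_assoc, ksign_mul_self])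
    (by
      refine LinearMap.ext fun α => LinearMap.ext fun z => ?_
      simp [← mul_assoc, ksign_mul_self])

theorem suspDualEquiv_apply (X : PSSet.{u}) (n : ℤ) (h : -(n + 1) + 1 = -n)
    (α : Module.Dual R (Cell X (-(n + 1)) →₀ R)) (z : Cell X (-(n + 1)) →₀ R) :
    suspDualEquiv R X n α (suspLinEquiv R X h z) = ksign R (n + 1) * α z := by
  simp [suspDualEquiv]

theorem dual_ext_suspLinEquiv {X : PSSet.{u}} {m n : ℤ} (h : m + 1 = n)
    {α β : Module.Dual R (Cell X.susp n →₀ R)}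
    (hαβ : ∀ z, α (suspLinEquiv R X h z) = β (suspLinEquiv R X h z)) : α = β := by
  refine LinearMap.ext fun y => ?_
  obtain ⟨z, rfl⟩ := (suspLinEquiv R X h).surjective y
  exact hαβ z

/-- The isomorphism `s⁻¹ Ñ^*(X) ≅ Ñ^*(ΣX)`. -/
noncomputable def cochainsSuspIso (R : Type v) [CommRing R] (X : PSSet.{u}) :
    desuspC (cochains R X) ≅ cochains R X.susp :=
  HomologicalComplex.Hom.isoOfComponents
    (fun n => (suspDualEquiv R X n).toModuleIso)
    (fun i j hij => by
      rw [ComplexShape.down_Rel] at hij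
      subst hij
      refine ModuleCat.hom_ext (LinearMap.ext fun (α : Module.Dual R (Cell X (-(j + 1 + 1)) →₀ R)) => ?_)
      have hj : -(j + 1) + 1 = -j := by omega
      have hi : -(j + 1 + 1) + 1 = -(j + 1) := by omega
      refine dual_ext_suspLinEquiv hj fun z => ?_
      change -(ksign R (j + 1) * suspDualEquiv R X (j + 1) α
          (chainsD R X.susp (-j) (-(j + 1)) (suspLinEquiv R X hj z))) =
        suspDualEquiv R X j (-(-(ksign R (j + 1 + 1) • (chainsD R X (-(j + 1)) (-(j + 1 + 1))).dualMap α)))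
          (suspLinEquiv R X hj z)
      -- On the left, the minus of the dual differential cancels the one of the suspension. On the
      -- right, the minus signs of the desuspension and of the dual cancel. Both sides are then the
      -- signs of `j + 1` and `j + 2` times `α (d z)`.
      rw [suspLinEquiv_chainsD R X hj hi, map_neg, suspDualEquiv_apply, suspDualEquiv_apply, neg_neg]
      simp)

variable {P : ℕ → ℤ → Type*} [∀ r d, AddCommGroup (P r d)] [∀ r d, Module R (P r d)]

/-- The isomorphism `x ↦ (x, 1)` commutes with the cooperations, where `Ñ_*(X)` is suspended along
`σ`. -/
def SuspCompatible {X : PSSet.{u}} (ρ : Coops P (chains R X)) (ρ' : Coops P (chains R X.susp))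
    (σ : ∀ r d, P r d →ₗ[R] Desusp P r d) : Prop :=
  ∀ (r : ℕ) (d : ℤ) (a : P r d) (m n : ℤ) (h : m + 1 = n) (p q : Fin r → ℤ)
    (hpq : ∀ i, p i + 1 = q i) (z : Cell X m →₀ R),
    (ρ' r d a n q (suspLinEquiv R X h z) : ⨂[R] i, (Cell X.susp (q i) →₀ R)) =
      suspTensor R X hpq (ksign R ((d - r + 1) + ∑ i : Fin r, p i * ((r : ℤ) - 1 - (i : ℕ))) •
        (ρ r (d - r + 1) (σ r d a) m p z : ⨂[R] i, (Cell X (p i) →₀ R)))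

/-- The cooperations of elements of degree `d` have degree `d`. -/
def Homogeneous {X : PSSet.{u}} (ρ : Coops P (chains R X)) : Prop :=
  ∀ (r : ℕ) (d : ℤ) (a : P r d) (n : ℤ) (p : Fin r → ℤ) (z : Cell X n →₀ R),
    ∑ i, p i ≠ n + d → (ρ r d a n p z : ⨂[R] i, (Cell X (p i) →₀ R)) = 0

/-- The case of degrees `n - 1` and `n`. The dual statement takes `-(n + 1)` and `-n` instead, which
is why `SuspCompatible` leaves the two degrees free. -/
theorem SuspCompatible.isCoalgHom {X : PSSet.{u}} {ρ : Coops P (chains R X)}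
    {ρ' : Coops P (chains R X.susp)} {σ : ∀ r d, P r d →ₗ[R] Desusp P r d}
    (h : SuspCompatible ρ ρ' σ) :
    IsCoalgHom (ρ.susp.pullback σ) ρ' (chainsSuspIso R X).hom := by
  intro r d a n p z
  exact (h r d a (n - 1) n (sub_add_cancel n 1) (fun i => p i - 1) p
    (fun i => sub_add_cancel (p i) 1) z).symm

/-- Compares the Koszul signs of tensor products of cochains before and after desuspension: each `p
i` lies in `r - 1` pairs, and the constant term counts the pairs. -/
theorem sum_filter_lt_add_one_mul {r : ℕ} (p : Fin r → ℤ) :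
    ∑ i, ∑ j ∈ Finset.univ.filter (· < i), (p i + 1) * (p j + 1) =
      ∑ i, ∑ j ∈ Finset.univ.filter (· < i), p i * p j + ((r : ℤ) - 1) * ∑ i, p i +
        (r * (r - 1) / 2 : ℕ) := by
  have h1 : ∀ i : Fin r, (Finset.univ.filter (· < i) : Finset (Fin r)) = Finset.Iio i := fun i => by ext; simp
  have h2 : ∑ i : Fin r, ∑ j ∈ Finset.univ.filter (· < i), p j =
      ∑ i : Fin r, p i * ((r : ℤ) - 1 - (i : ℕ)) := by
    simp only [Finset.sum_filter]
    rw [Finset.sum_comm]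
    refine Finset.sum_congr rfl fun i _ => ?_
    rw [← Finset.sum_filter]
    have : (Finset.univ.filter fun j => i < j) = Finset.Ioi i := by ext; simp
    rw [this, Finset.sum_const, Fin.card_Ioi, nsmul_eq_mul, mul_comm]
    congr 1
    have := i.isLt
    omega
  have h3 : ((r * (r - 1) / 2 : ℕ) : ℤ) = ∑ i : Fin r, ((i : ℕ) : ℤ) := by
    rw [← Finset.sum_range_id, ← Fin.sum_univ_eq_sum_range (fun i => i), Nat.cast_sum]
  have h4 : ∀ i : Fin r, ∑ j ∈ Finset.univ.filter (· < i), (p i + 1) * (p j + 1) =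
      ∑ j ∈ Finset.univ.filter (· < i), p i * p j + ∑ j ∈ Finset.univ.filter (· < i), p j +
        ((i : ℕ) : ℤ) * (p i + 1) := by
    intro i
    have h5 : ((i : ℕ) : ℤ) * (p i + 1) = ∑ _j ∈ Finset.univ.filter (· < i), (p i + 1) := by
      rw [h1, Finset.sum_const, Fin.card_Iio, nsmul_eq_mul]
    rw [h5, ← Finset.sum_add_distrib, ← Finset.sum_add_distrib]
    exact Finset.sum_congr rfl fun j _ => by ring
  have h5 : ∑ i : Fin r, p i * ((r : ℤ) - 1 - (i : ℕ)) + ∑ i : Fin r, ((i : ℕ) : ℤ) * (p i + 1) =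
      ((r : ℤ) - 1) * ∑ i, p i + ∑ i : Fin r, ((i : ℕ) : ℤ) := by
    rw [Finset.mul_sum, ← Finset.sum_add_distrib, ← Finset.sum_add_distrib]
    exact Finset.sum_congr rfl fun i _ => by ring
  simp only [h4]
  rw [Finset.sum_add_distrib, Finset.sum_add_distrib, h2, h3, add_assoc, h5, add_assoc]

theorem prod_ksign {ι : Type*} (s : Finset ι) (f : ι → ℤ) :
    ∏ i ∈ s, ksign R (f i) = ksign R (∑ i ∈ s, f i) := by
  classical
  induction s using Finset.induction_on with
  | empty => simp [ksign]
  | insert a s ha ih => rw [Finset.prod_insert ha, Finset.sum_insert ha, ksign_add, ih]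

theorem dualDistrib_suspTensor (X : PSSet.{u}) {r : ℕ} (p : Fin r → ℤ)
    (hp : ∀ i, -(p i + 1) + 1 = -p i)
    (α : ∀ i, Module.Dual R (Cell X (-(p i + 1)) →₀ R))
    (c : R) (t : ⨂[R] i, (Cell X (-(p i + 1)) →₀ R)) :
    PiTensorProduct.dualDistrib (⨂ₜ[R] i, suspDualEquiv R X (p i) (α i))
        (suspTensor R X hp (c • t)) =
      ksign R (∑ i, (p i + 1)) * (c * PiTensorProduct.dualDistrib (⨂ₜ[R] i, α i) t) := by
  suffices h : PiTensorProduct.dualDistrib (⨂ₜ[R] i, suspDualEquiv R X (p i) (α i)) ∘ₗ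
      suspTensor R X hp = ksign R (∑ i, (p i + 1)) • PiTensorProduct.dualDistrib (⨂ₜ[R] i, α i) by
    have := LinearMap.congr_fun h (c • t)
    rwa [LinearMap.smul_apply, map_smul (PiTensorProduct.dualDistrib (⨂ₜ[R] i, α i))] at this
  refine PiTensorProduct.ext (MultilinearMap.ext fun z => ?_)
  simp only [LinearMap.compMultilinearMap_apply, LinearMap.comp_apply, suspTensor,
    PiTensorProduct.map_tprod, PiTensorProduct.dualDistrib_apply, LinearEquiv.coe_coe,
    suspDualEquiv_apply, Finset.prod_mul_distrib, prod_ksign, LinearMap.smul_apply, smul_eq_mul]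

/-- Both sides are multiples of the value of `α_1 ⊗ … ⊗ α_r` on the same element `y`, so only signs
are to be compared. They involve `n`, `d` and the `p i`, and homogeneity of `ρ` gives the relation
between these unless `y = 0`. -/
theorem SuspCompatible.isAlgHom {X : PSSet.{u}} {ρ : Coops P (chains R X)}
    {ρ' : Coops P (chains R X.susp)} {σ : ∀ r d, P r d →ₗ[R] Desusp P r d}
    (h : SuspCompatible ρ ρ' σ) (hρ : Homogeneous ρ) :
    IsAlgHom (ρ.dual.desusp.pullback σ) ρ'.dual (cochainsSuspIso R X).hom := by
  intro r d a p n x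
  have hn : -(n + 1) + 1 = -n := by omega
  have hp : ∀ i, -(p i + 1) + 1 = -p i := fun i => by omega
  refine dual_ext_suspLinEquiv hn fun z => ?_
  set y : ⨂[R] i, (Cell X (-(p i + 1)) →₀ R) :=
    ρ r (d - r + 1) (σ r d a) (-(n + 1)) (fun i => -(p i + 1)) z
  let α : ∀ i, Module.Dual R (Cell X (-(p i + 1)) →₀ R) := x
  have e1 : suspDualEquiv R X n ((ρ.dual.desusp.pullback σ) r d a p n x) (suspLinEquiv R X hn z) =
      ksign R (n + 1) * (ksign R (r * (d - r + 1) +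
          ∑ i : Fin r, (p i + 1) * ((r : ℤ) - 1 - (i : ℕ)) + (r * (r - 1) / 2 : ℕ)) *
        (ksign R ((d - r + 1) * ∑ i, (p i + 1) +
            ∑ i, ∑ j ∈ Finset.univ.filter (· < i), (p i + 1) * (p j + 1)) *
          PiTensorProduct.dualDistrib (⨂ₜ[R] i, α i) y)) :=
    suspDualEquiv_apply X n hn ((ρ.dual.desusp.pullback σ) r d a p n x) z
  have e2 : (ρ'.dual r d a p n (fun i => (cochainsSuspIso R X).hom.f (p i) (x i)) :
        Module.Dual R (Cell X.susp (-n) →₀ R)) (suspLinEquiv R X hn z) =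
      ksign R (d * ∑ i, p i + ∑ i, ∑ j ∈ Finset.univ.filter (· < i), p i * p j) *
        PiTensorProduct.dualDistrib (⨂ₜ[R] i, suspDualEquiv R X (p i) (α i))
          (ρ' r d a (-n) (fun i => -p i) (suspLinEquiv R X hn z) :
            ⨂[R] i, (Cell X.susp (-p i) →₀ R)) := rfl
  have e3 : PiTensorProduct.dualDistrib (⨂ₜ[R] i, suspDualEquiv R X (p i) (α i))
      (ρ' r d a (-n) (fun i => -p i) (suspLinEquiv R X hn z) :
        ⨂[R] i, (Cell X.susp (-p i) →₀ R)) = ksign R (∑ i, (p i + 1)) *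
      (ksign R ((d - r + 1) + ∑ i : Fin r, -(p i + 1) * ((r : ℤ) - 1 - (i : ℕ))) *
        PiTensorProduct.dualDistrib (⨂ₜ[R] i, α i) y) :=
    (congrArg _ (h r d a _ _ hn _ _ hp z)).trans
      (dualDistrib_suspTensor X p hp α _ y)
  have hy0 : ∑ i, -(p i + 1) ≠ -(n + 1) + (d - r + 1) → y = 0 := hρ _ _ _ _ _ _
  refine e1.trans (Eq.trans ?_ (e2.trans (congrArg _ e3)).symm)
  clear_value y
  by_cases hs : ∑ i, -(p i + 1) = -(n + 1) + (d - r + 1)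
  · simp only [← mul_assoc, ← ksign_add]
    congr 1
    have hQ : ∑ i, (p i + 1) = ∑ i, p i + r := by
      rw [Finset.sum_add_distrib]; simp
    have hA : ∑ i : Fin r, -(p i + 1) * ((r : ℤ) - 1 - (i : ℕ)) =
        -∑ i : Fin r, (p i + 1) * ((r : ℤ) - 1 - (i : ℕ)) := by
      rw [← Finset.sum_neg_distrib]
      exact Finset.sum_congr rfl fun i _ => by ring
    rw [Finset.sum_neg_distrib, hQ] at hs
    have hn' : n + 1 = ∑ i, p i + r + (d - r + 1) := by omega
    rw [sum_filter_lt_add_one_mul, hQ, hA, hn']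
    -- The two exponents differ by twice the exponent of the sign in `Ops.desusp`.
    refine ksign_congr R (r * (d - r + 1) + ∑ i : Fin r, (p i + 1) * ((r : ℤ) - 1 - (i : ℕ)) +
      (r * (r - 1) / 2 : ℕ)) ?_
    ring
  · rw [hy0 hs]
    simp

theorem suspCompatible_chainsCoops (R : Type v) [CommRing R] (X : PSSet.{u}) :
    SuspCompatible (chainsCoops R X) (chainsCoops R X.susp) (sigmaSurj R) :=
  fun _ _ a _ _ h _ _ hpq z => cellCoops_suspLinEquiv R X a h hpq z

theorem homogeneous_chainsCoops (R : Type v) [CommRing R] (X : PSSet.{u}) :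
    Homogeneous (chainsCoops R X) :=
  fun _ _ a _ _ z hp => cellCoops_eq_zero R X a hp z

theorem suspCompatible_chainsCoopsBE (R : Type v) [CommRing R] (X : PSSet.{u}) :
    SuspCompatible (chainsCoopsBE R X) (chainsCoopsBE R X.susp) (sigmaBE R) := by
  intro r d a m n h p q hpq z
  have := cellCoops_suspLinEquiv R X (tableReduction R r d a) h hpq z
  rw [sigmaSurj_tableReduction] at this
  exact this

theorem homogeneous_chainsCoopsBE (R : Type v) [CommRing R] (X : PSSet.{u}) :
    Homogeneous (chainsCoopsBE R X) :=
  fun r d a _ _ z hp => cellCoops_eq_zero R X (tableReduction R r d a) hp z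

end

end EInftySusp

theorem theorem1p2 (R : Type v) [CommRing R] :
    (∃ φ : ∀ X : PSSet.{u}, suspC (chains R X) ≅ chains R X.susp,
      (∀ (X : PSSet.{u}) (n : ℤ) (k : ℕ) (x : X.sset _⦋k⦌),
        (φ X).hom.f n (cls R X (n - 1) x) = cls R X.susp n (X.inSusp 1 x)) ∧
      (∀ (X Y : PSSet.{u}) (f : X.Hom Y),
        suspCMap (chainsMap R f) ≫ (φ Y).hom = (φ X).hom ≫ chainsMap R f.susp) ∧
      (∀ X : PSSet.{u},
        IsCoalgHom ((chainsCoops R X).susp.pullback (sigmaSurj R)) (chainsCoops R X.susp)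
          (φ X).hom) ∧
      (∀ X : PSSet.{u},
        IsCoalgHom ((chainsCoopsBE R X).susp.pullback (sigmaBE R)) (chainsCoopsBE R X.susp)
          (φ X).hom)) ∧
    (∃ ψ : ∀ X : PSSet.{u}, desuspC (cochains R X) ≅ cochains R X.susp,
      (∀ (X : PSSet.{u}) (n : ℤ) (α : Module.Dual R ((chains R X).X (-(n + 1)))) (k : ℕ)
        (x : X.sset _⦋k⦌),
        ((ψ X).hom.f n α : Module.Dual R ((chains R X.susp).X (-n)))
            (cls R X.susp (-n) (X.inSusp 1 x)) =
          ksign R (n + 1) * α (cls R X (-(n + 1)) x)) ∧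
      (∀ (X Y : PSSet.{u}) (f : X.Hom Y),
        desuspCMap (dualCMap (chainsMap R f)) ≫ (ψ X).hom =
          (ψ Y).hom ≫ dualCMap (chainsMap R f.susp)) ∧
      (∀ X : PSSet.{u},
        IsAlgHom ((cochainsOps R X).desusp.pullback (sigmaSurj R)) (cochainsOps R X.susp)
          (ψ X).hom) ∧
      (∀ X : PSSet.{u},
        IsAlgHom ((cochainsOpsBE R X).desusp.pullback (sigmaBE R)) (cochainsOpsBE R X.susp)
          (ψ X).hom)) := by
  refine ⟨⟨chainsSuspIso R, ?_, ?_, fun X => (suspCompatible_chainsCoops R X).isCoalgHom,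
    fun X => (suspCompatible_chainsCoopsBE R X).isCoalgHom⟩,
    ⟨cochainsSuspIso R, ?_, ?_,
      fun X => (suspCompatible_chainsCoops R X).isAlgHom (homogeneous_chainsCoops R X),
      fun X => (suspCompatible_chainsCoopsBE R X).isAlgHom (homogeneous_chainsCoopsBE R X)⟩⟩
  · intro X n k x
    exact suspLinEquiv_cls_cone R X _ rfl x
  · intro X Y f
    refine HomologicalComplex.hom_ext _ _ fun n => ModuleCat.hom_ext (LinearMap.ext fun z => ?_)
    exact suspLinEquiv_natural R f _ z
  · intro X n α k x
    have h : -(n + 1) + 1 = -n := by omega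
    have := suspDualEquiv_apply X n h α (cls R X (-(n + 1)) x)
    rw [suspLinEquiv_cls_cone R X h rfl x] at this
    exact this
  · intro X Y f
    refine HomologicalComplex.hom_ext _ _ fun n => ModuleCat.hom_ext
      (LinearMap.ext fun (α : Module.Dual R (Cell Y (-(n + 1)) →₀ R)) => ?_)
    have h : -(n + 1) + 1 = -n := by omega
    refine dual_ext_suspLinEquiv h fun z => ?_
    refine (suspDualEquiv_apply X n h _ z).trans ?_
    refine ((congrArg (suspDualEquiv R Y n α) (suspLinEquiv_natural R f h z).symm).trans
      (suspDualEquiv_apply Y n h α _)).symm
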